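/- Conventions. Write $\mathrm{U}_n\le \mathrm{GL}_n$ for the group scheme of upper unitriangular $n\times n$ matrices. Given a closed subgroup scheme $G\le \mathrm{U}_n\otimes\mathbf{Q}$ and a commutative ring $R$, write $G(R)\le \mathrm{GL}_n(R)$ for the group of $R$-points of the scheme-theoretic closure of $G$ in $\mathrm{GL}_n$ over $\mathbf{Z}$; that is, $G(R)$ consists of the matrices over $R$ at which all those polynomials with integer coefficients vanish that belong to the vanishing ideal of $G$ over $\mathbf{Q}$. For a finite field $\mathbf{F}_q$ with $q$ elements, $\#(\mathbf{F}_q^n/G(\mathbf{F}_q))$ is the number of orbits of $G(\mathbf{F}_q)$ acting on row vectors in $\mathbf{F}_q^n$ by right multiplication, and $k(G(\mathbf{F}_q))$ is the number of conjugacy classes of $G(\mathbf{F}_q)$. Proposition B. Let $G\le \mathrm{U}_n\otimes\mathbf{Q}$ be a closed subgroup scheme (a unipotent algebraic group) of dimension $d$ over $\mathbf{Q}$. (i) There exist a commutative closed subgroup scheme $M\le \mathrm{U}_{2n}\otimes\mathbf{Q}$ of dimension $d$ over $\mathbf{Q}$ and an integer $u\ge 1$ such that $$\#(\mathbf{F}_q^n/G(\mathbf{F}_q))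 = q^{-n}\cdot \#(\mathbf{F}_q^{2n}/M(\mathbf{F}_q))$$ for all prime powers $q$ with $\gcd(q,u)=1$. (ii) There exist a unipotent algebraic group $H$ over $\mathbf{Q}$ (a closed subgroup scheme $H\le \mathrm{U}_m\otimes\mathbf{Q}$ for some $m$) of nilpotency class at most $2$ and dimension $2d$ and an integer $v\ge 1$ such that $$k(G(\mathbf{F}_q)) = q^{-d}\cdot k(H(\mathbf{F}_q))$$ for all prime powers $q$ with $\gcd(q,v)=1$. -/

import Mathlib

open scoped Matrix TensorProduct

noncomputable section

/-- The `n × n` matrix `A` over the `S`-algebra `R` is a common zero of the polynomials in the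
ideal `I`; the variable `X (i, j)` stands for the `(i, j)` entry of a matrix. -/
def MatrixZero {n : ℕ} {S R : Type*} [CommRing S] [CommRing R] [Algebra S R]
    (I : Ideal (MvPolynomial (Fin n × Fin n) S)) (A : Matrix (Fin n) (Fin n) R) : Prop :=
  ∀ f ∈ I, MvPolynomial.aeval (fun p : Fin n × Fin n => A p.1 p.2) f = 0

/-- A closed subgroup scheme `G` of `U_n ⊗ ℚ`, where `U_n ≤ GL_n` is the group scheme of upper
unitriangular matrices.  It is given by its vanishing ideal in the polynomial ring `ℚ[X_ij]` on
the space of all `n × n` matrices: `lower_mem` and `diag_mem` say that the closed subscheme cut out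
by this ideal is contained in the closed subscheme `U_n ⊗ ℚ`, the remaining fields say that its
`R`-points form a group under matrix multiplication, for each commutative `ℚ`-algebra `R`. -/
structure UnitriangularAlgGroup (n : ℕ) where
  ideal : Ideal (MvPolynomial (Fin n × Fin n) ℚ)
  lower_mem : ∀ i j : Fin n, j < i → MvPolynomial.X (i, j) ∈ ideal
  diag_mem : ∀ i : Fin n, MvPolynomial.X (i, i) - 1 ∈ ideal
  one_mem : ∀ (R : Type) [CommRing R] [Algebra ℚ R],
    MatrixZero ideal (1 : Matrix (Fin n) (Fin n) R)
  mul_mem : ∀ (R : Type) [CommRing R] [Algebra ℚ R] (A B : Matrix (Fin n) (Fin n) R),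
    MatrixZero ideal A → MatrixZero ideal B → MatrixZero ideal (A * B)
  inv_mem : ∀ (R : Type) [CommRing R] [Algebra ℚ R] (A B : Matrix (Fin n) (Fin n) R),
    A * B = 1 → MatrixZero ideal A → MatrixZero ideal B

/-- Evaluation at the entries of a matrix commutes with ring homomorphisms. -/
theorem aeval_matrix_map {n : ℕ} {R R' : Type*} [CommRing R] [CommRing R']
    (φ : R →+* R') (A : Matrix (Fin n) (Fin n) R) (f : MvPolynomial (Fin n × Fin n) ℤ) :
    MvPolynomial.aeval (fun p : Fin n × Fin n => (A.map φ) p.1 p.2) f =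
      φ (MvPolynomial.aeval (fun p : Fin n × Fin n => A p.1 p.2) f) := by
  have := MvPolynomial.map_aeval (fun p : Fin n × Fin n => A p.1 p.2) φ f
  rw [this, MvPolynomial.aeval_def, MvPolynomial.coe_eval₂Hom]
  congr 1
  exact Subsingleton.elim _ _

/-- A rational polynomial times a suitable positive integer is integral. -/
theorem exists_clear_denominators {σ : Type*} (f : MvPolynomial σ ℚ) :
    ∃ (N : ℕ) (g : MvPolynomial σ ℤ), 0 < N ∧
      MvPolynomial.map (Int.castRingHom ℚ) g = (N : ℚ) • f := by
  induction f using MvPolynomial.induction_on with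
  | C a =>
    refine ⟨a.den, MvPolynomial.C a.num, a.den_pos, ?_⟩
    rw [MvPolynomial.map_C, MvPolynomial.smul_eq_C_mul, ← MvPolynomial.C_mul]
    congr 1
    simp [mul_comm, Rat.mul_den_eq_num]
  | add p q hp hq =>
    obtain ⟨N, g, hN, hg⟩ := hp
    obtain ⟨N', g', hN', hg'⟩ := hq
    refine ⟨N * N', (N' : ℤ) • g + (N : ℤ) • g', Nat.mul_pos hN hN', ?_⟩
    rw [map_add, map_zsmul, map_zsmul, hg, hg']
    simp only [MvPolynomial.smul_eq_C_mul, zsmul_eq_mul]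
    push_cast
    simp only [map_mul, map_natCast]
    ring
  | mul_X p i hp =>
    obtain ⟨N, g, hN, hg⟩ := hp
    exact ⟨N, g * MvPolynomial.X i, hN, by rw [map_mul, hg, MvPolynomial.map_X, smul_mul_assoc]⟩

namespace UnitriangularAlgGroup

variable {n : ℕ} (G : UnitriangularAlgGroup n)

/-- The coordinate ring `ℚ[G]`. -/
abbrev CoordRing : Type := MvPolynomial (Fin n × Fin n) ℚ ⧸ G.ideal

/-- The dimension of `G`: the Krull dimension of its coordinate ring. -/
def dim : WithBot ℕ∞ := ringKrullDim G.CoordRing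

/-- The ideal of the scheme-theoretic closure of `G` over `ℤ`: all integral polynomials in the
vanishing ideal of `G`. -/
def intIdeal : Ideal (MvPolynomial (Fin n × Fin n) ℤ) :=
  G.ideal.comap (MvPolynomial.map (Int.castRingHom ℚ))

/-- Over a `ℚ`-algebra, the closure of `G` has the same points as `G`. -/
theorem matrixZero_intIdeal_iff {R : Type*} [CommRing R] [Algebra ℚ R]
    (A : Matrix (Fin n) (Fin n) R) : MatrixZero G.intIdeal A ↔ MatrixZero G.ideal A := by
  have key : ∀ g : MvPolynomial (Fin n × Fin n) ℤ,
      MvPolynomial.aeval (fun p : Fin n × Fin n => A p.1 p.2)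
        (MvPolynomial.map (Int.castRingHom ℚ) g) =
      MvPolynomial.aeval (fun p : Fin n × Fin n => A p.1 p.2) g := by
    intro g
    exact MvPolynomial.aeval_map_algebraMap ℚ _ g
  constructor
  · intro h f hf
    obtain ⟨N, g, hN, hg⟩ := exists_clear_denominators f
    have hgI : g ∈ G.intIdeal := by
      change MvPolynomial.map (Int.castRingHom ℚ) g ∈ G.ideal
      rw [hg, MvPolynomial.smul_eq_C_mul]
      exact G.ideal.mul_mem_left _ hf
    have h0 := h g hgI
    rw [← key, hg, map_smul] at h0
    have hN' : (N : ℚ) ≠ 0 := by exact_mod_cast hN.ne'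
    have := congrArg (fun x => (N : ℚ)⁻¹ • x) h0
    simpa [smul_smul, hN'] using this
  · intro h g hg
    rw [← key]
    exact h _ hg

/-- The coordinate ring of the closure of `G` over `ℤ`. -/
abbrev IntCoordRing : Type := MvPolynomial (Fin n × Fin n) ℤ ⧸ G.intIdeal

/-- The universal point of the closure of `G`. -/
def univ : Matrix (Fin n) (Fin n) G.IntCoordRing :=
  fun i j => Ideal.Quotient.mk _ (MvPolynomial.X (i, j))

theorem aeval_univ (f : MvPolynomial (Fin n × Fin n) ℤ) :
    MvPolynomial.aeval (fun p : Fin n × Fin n => G.univ p.1 p.2) f =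
      Ideal.Quotient.mk G.intIdeal f := by
  have : MvPolynomial.aeval (fun p : Fin n × Fin n => G.univ p.1 p.2) =
      (Ideal.Quotient.mkₐ ℤ G.intIdeal) := by
    ext p
    simp [univ]
  rw [this]; rfl

theorem matrixZero_univ : MatrixZero G.intIdeal G.univ := by
  intro f hf
  rw [aeval_univ]
  exact Ideal.Quotient.eq_zero_iff_mem.2 hf

theorem matrixZero_map {R R' : Type*} [CommRing R] [CommRing R'] (φ : R →+* R')
    {A : Matrix (Fin n) (Fin n) R} (h : MatrixZero G.intIdeal A) :
    MatrixZero G.intIdeal (A.map φ) := by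
  intro f hf
  rw [aeval_matrix_map, h f hf, map_zero]

/-- A point of the closure of `G` is the image of the universal point. -/
theorem exists_hom {R : Type*} [CommRing R] {A : Matrix (Fin n) (Fin n) R}
    (h : MatrixZero G.intIdeal A) : ∃ φ : G.IntCoordRing →+* R, G.univ.map φ = A := by
  refine ⟨Ideal.Quotient.lift G.intIdeal
    (MvPolynomial.aeval (fun p : Fin n × Fin n => A p.1 p.2)).toRingHom h, ?_⟩
  ext i j
  simp [univ]

/-- The points of the closure of `G` are upper unitriangular, hence of determinant `1`. -/
theorem det_of_matrixZero {R : Type*} [CommRing R] {A : Matrix (Fin n) (Fin n) R}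
    (h : MatrixZero G.intIdeal A) : A.det = 1 := by
  have hl : ∀ i j : Fin n, j < i → A i j = 0 := by
    intro i j hij
    have := h (MvPolynomial.X (i, j)) (by
      change MvPolynomial.map (Int.castRingHom ℚ) _ ∈ G.ideal
      simpa using G.lower_mem i j hij)
    simpa using this
  have hd : ∀ i : Fin n, A i i = 1 := by
    intro i
    have := h (MvPolynomial.X (i, i) - 1) (by
      change MvPolynomial.map (Int.castRingHom ℚ) _ ∈ G.ideal
      simpa using G.diag_mem i)
    exact sub_eq_zero.1 (by simpa using this)
  rw [Matrix.det_of_isUpperTriangular (fun i j hij => hl i j hij)]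
  simp [hd]

instance : Module.Flat ℤ G.IntCoordRing := by
  have : Module.IsTorsionFree ℤ G.IntCoordRing := by
    refine Module.IsTorsionFree.mk ?_
    intro k hk x y hxy
    obtain ⟨f, rfl⟩ := Ideal.Quotient.mk_surjective x
    obtain ⟨g, rfl⟩ := Ideal.Quotient.mk_surjective y
    have hk0 : k ≠ 0 := hk.ne_zero
    have hmem : k • (f - g) ∈ G.intIdeal := by
      rw [← Ideal.Quotient.eq_zero_iff_mem, map_zsmul, map_sub, smul_sub]
      exact sub_eq_zero.2 hxy
    refine Ideal.Quotient.eq.2 ?_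
    change MvPolynomial.map (Int.castRingHom ℚ) _ ∈ G.ideal at hmem ⊢
    rw [map_zsmul] at hmem
    have h2 := G.ideal.mul_mem_left (MvPolynomial.C ((k : ℚ)⁻¹)) hmem
    rw [zsmul_eq_mul, ← mul_assoc,
      ← map_intCast (MvPolynomial.C : ℚ →+* MvPolynomial (Fin n × Fin n) ℚ) k,
      ← MvPolynomial.C_mul, inv_mul_cancel₀ (by exact_mod_cast hk0), MvPolynomial.C_1,
      one_mul] at h2
    exact h2
  infer_instance

/-- The extension of scalars of a ring `B` to a `ℚ`-algebra. -/
def toRat (B : Type) [CommRing B] : B →+* ℚ ⊗[ℤ] B :=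
  (Algebra.TensorProduct.includeRight : B →ₐ[ℤ] ℚ ⊗[ℤ] B).toRingHom

theorem toRat_injective (B : Type) [CommRing B] [Module.Flat ℤ B] :
    Function.Injective (toRat B) :=
  Algebra.TensorProduct.includeRight_injective (R := ℤ) (A := ℚ) (B := B)
    (algebraMap ℤ ℚ).injective_int

theorem matrixZero_of_toRat {B : Type} [CommRing B] [Module.Flat ℤ B]
    {A : Matrix (Fin n) (Fin n) B} (h : MatrixZero G.ideal (A.map (toRat B))) :
    MatrixZero G.intIdeal A := by
  intro f hf
  have h0 := (G.matrixZero_intIdeal_iff _).2 h f hf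
  rw [aeval_matrix_map] at h0
  exact toRat_injective B (h0.trans (map_zero _).symm)

theorem matrixZero_mul_of_flat {B : Type} [CommRing B] [Module.Flat ℤ B]
    {A A' : Matrix (Fin n) (Fin n) B} (hA : MatrixZero G.intIdeal A)
    (hA' : MatrixZero G.intIdeal A') : MatrixZero G.intIdeal (A * A') := by
  apply G.matrixZero_of_toRat
  rw [Matrix.map_mul]
  exact G.mul_mem _ _ _ ((G.matrixZero_intIdeal_iff _).1 (G.matrixZero_map _ hA))
    ((G.matrixZero_intIdeal_iff _).1 (G.matrixZero_map _ hA'))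

theorem matrixZero_inv_of_flat {B : Type} [CommRing B] [Module.Flat ℤ B]
    {A A' : Matrix (Fin n) (Fin n) B} (h : A * A' = 1) (hA : MatrixZero G.intIdeal A) :
    MatrixZero G.intIdeal A' := by
  apply G.matrixZero_of_toRat
  refine G.inv_mem _ (A.map (toRat B)) _ ?_
    ((G.matrixZero_intIdeal_iff _).1 (G.matrixZero_map _ hA))
  rw [← Matrix.map_mul, h, Matrix.map_one _ (map_zero _) (map_one _)]

theorem matrixZero_one {R : Type*} [CommRing R] :
    MatrixZero G.intIdeal (1 : Matrix (Fin n) (Fin n) R) := by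
  have hZ : MatrixZero G.intIdeal (1 : Matrix (Fin n) (Fin n) ℤ) := by
    intro f hf
    have h := (G.matrixZero_intIdeal_iff (1 : Matrix (Fin n) (Fin n) ℚ)).2 (G.one_mem ℚ) f hf
    have h1 : (1 : Matrix (Fin n) (Fin n) ℚ) =
        (1 : Matrix (Fin n) (Fin n) ℤ).map (Int.castRingHom ℚ) := by
      rw [Matrix.map_one _ (map_zero _) (map_one _)]
    rw [h1, aeval_matrix_map] at h
    exact (Int.castRingHom ℚ).injective_int (by rw [h, map_zero])
  have := G.matrixZero_map (Int.castRingHom R) hZ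
  rwa [Matrix.map_one _ (map_zero _) (map_one _)] at this

theorem matrixZero_map_mul_map {R : Type*} {B : Type} [CommRing R] [CommRing B]
    [Module.Flat ℤ B] {U : Matrix (Fin n) (Fin n) B} (hU : MatrixZero G.intIdeal U)
    (φ ψ : B →+* R) : MatrixZero G.intIdeal (U.map φ * U.map ψ) := by
  let l : B →+* B ⊗[ℤ] B := (Algebra.TensorProduct.includeLeft : B →ₐ[ℤ] B ⊗[ℤ] B).toRingHom
  let r : B →+* B ⊗[ℤ] B := (Algebra.TensorProduct.includeRight : B →ₐ[ℤ] B ⊗[ℤ] B).toRingHom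
  have : Module.Flat ℤ (B ⊗[ℤ] B) := by
    have h : @Module.Flat ℤ (B ⊗[ℤ] B) _ _ TensorProduct.leftModule := inferInstance
    convert h
    exact Subsingleton.elim _ _
  have hT : MatrixZero G.intIdeal (U.map l * U.map r) :=
    G.matrixZero_mul_of_flat (G.matrixZero_map l hU) (G.matrixZero_map r hU)
  let χ : B ⊗[ℤ] B →+* R := (Algebra.TensorProduct.lift φ.toIntAlgHom ψ.toIntAlgHom
    (fun _ _ => Commute.all _ _)).toRingHom
  have h := G.matrixZero_map χ hT
  have hl : (U.map l).map χ = U.map φ := by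
    ext i j; simp [l, χ]
  have hr : (U.map r).map χ = U.map ψ := by
    ext i j; simp [r, χ]
  rwa [Matrix.map_mul, hl, hr] at h

theorem matrixZero_mul {R : Type*} [CommRing R] {A B : Matrix (Fin n) (Fin n) R}
    (hA : MatrixZero G.intIdeal A) (hB : MatrixZero G.intIdeal B) :
    MatrixZero G.intIdeal (A * B) := by
  obtain ⟨φ, rfl⟩ := G.exists_hom hA
  obtain ⟨ψ, rfl⟩ := G.exists_hom hB
  exact G.matrixZero_map_mul_map G.matrixZero_univ φ ψ

theorem matrixZero_inv {R : Type*} [CommRing R] {A B : Matrix (Fin n) (Fin n) R}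
    (hAB : A * B = 1) (hA : MatrixZero G.intIdeal A) : MatrixZero G.intIdeal B := by
  obtain ⟨φ, rfl⟩ := G.exists_hom hA
  have hU : G.univ * G.univ.adjugate = 1 := by
    rw [Matrix.mul_adjugate, G.det_of_matrixZero G.matrixZero_univ, one_smul]
  have hadj : MatrixZero G.intIdeal G.univ.adjugate :=
    G.matrixZero_inv_of_flat hU G.matrixZero_univ
  have hB : B = G.univ.adjugate.map φ := by
    have h1 : G.univ.map φ * G.univ.adjugate.map φ = 1 := by
      rw [← Matrix.map_mul, hU, Matrix.map_one _ (map_zero _) (map_one _)]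
    calc B = (G.univ.adjugate.map φ * G.univ.map φ) * B := by
            rw [mul_eq_one_comm.1 h1, one_mul]
      _ = G.univ.adjugate.map φ := by rw [mul_assoc, hAB, mul_one]
  rw [hB]
  exact G.matrixZero_map φ hadj

/-- The group `G(R) ≤ GL_n(R)` for an arbitrary commutative ring `R`: the `R`-points of the
scheme-theoretic closure of `G` over `ℤ`. -/
def points (R : Type*) [CommRing R] : Subgroup (GL (Fin n) R) where
  carrier := {g | MatrixZero G.intIdeal (g : Matrix (Fin n) (Fin n) R)}
  one_mem' := G.matrixZero_one
  mul_mem' := fun ha hb => G.matrixZero_mul ha hb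
  inv_mem' := fun {g} hg => G.matrixZero_inv (Units.mul_inv g) hg

/-- `G` is commutative: so is `G(R)` for each commutative `ℚ`-algebra `R`. -/
def IsCommutative : Prop :=
  ∀ (R : Type) [CommRing R] [Algebra ℚ R] (a b : G.points R), a * b = b * a

/-- `G` has nilpotency class at most `c`: so does `G(R)` for each commutative `ℚ`-algebra `R`. -/
def ClassLE (c : ℕ) : Prop :=
  ∀ (R : Type) [CommRing R] [Algebra ℚ R],
    (⊤ : Subgroup (G.points R)).lowerCentralSeries c = ⊥

end UnitriangularAlgGroup

/-- The orbit equivalence relation of a matrix group acting on row vectors from the right. -/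
def linearOrbitSetoid {n : ℕ} {R : Type*} [CommRing R] (Γ : Subgroup (GL (Fin n) R)) :
    Setoid (Fin n → R) where
  r x y := ∃ g ∈ Γ, x ᵥ* (g : Matrix (Fin n) (Fin n) R) = y
  iseqv :=
    { refl := fun x => ⟨1, Γ.one_mem, by simp⟩
      symm := by
        rintro x y ⟨g, hg, rfl⟩
        exact ⟨g⁻¹, Γ.inv_mem hg, by
          rw [Matrix.vecMul_vecMul, Units.mul_inv, Matrix.vecMul_one]⟩
      trans := by
        rintro x y z ⟨g, hg, rfl⟩ ⟨h, hh, rfl⟩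
        exact ⟨g * h, Γ.mul_mem hg hh, by rw [Matrix.vecMul_vecMul, Units.val_mul]⟩ }

/-- The number `#(R^n / Γ)` of orbits of `Γ ≤ GL_n(R)` on `R^n`. -/
def numLinearOrbits {n : ℕ} {R : Type*} [CommRing R] (Γ : Subgroup (GL (Fin n) R)) : ℕ :=
  Nat.card (Quotient (linearOrbitSetoid Γ))

/-- The class number `k(Γ)`: the number of conjugacy classes of `Γ`. -/
def classNumber (Γ : Type*) [Group Γ] : ℕ := Nat.card (ConjClasses Γ)

end

/-! Let 𝔤 be the Lie algebra of G. The exponential is an isomorphism of varieties from 𝔤 to G, and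
it is already defined over a ring S = ℤ[1/N] for suitable N, hence makes sense over every finite
field F in which N is invertible. Both counts for G(F) thus become counts on the F-points of 𝔤, an
F-vector space of dimension d.

Orbits: by Burnside's lemma (`numLinearOrbits_mul_card`), the number of orbits times |G(F)| is the
number of pairs (g, x) with xg = x. As exp a - 1 and a are right multiples of each other, x is fixed
by exp a if and only if xa = 0 (`vecMul_algExp_eq_iff`). Take M to be the block matrices with rows
(1, a), (0, 1), a in 𝔤. Such a matrix fixes (x, y) under the same condition xa = 0, and the free
vector y accounts for the factor q^n.

Classes: k(G(F)) times |G(F)| is the number of commuting pairs, and exp a, exp b commute if and only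
if a, b do (`commute_of_commute_algExp`). Take H to be 𝔤 × 𝔤 with product (x, y)(x', y') = (x + x',
y + y' + [x, x']/2), realised by 3 × 3 block matrices. Commutation in H depends on x and x' only, so
H has q^(2d) times as many commuting pairs as 𝔤. Dividing by |H(F)| = q^(2d) instead of |G(F)| = q^d
leaves the factor q^d.

The algebraic core is that exp and log exchange 𝔤 and G over all ℚ-algebras (`isLie_algLog`,
`matrixZero_algExp`). This identifies the ideal of G with that of the exponential chart
(`ideal_expChart`), and `AffineChart.matrixZero_intIdeal_iff` carries the description to the closure
over ℤ at every ring that receives S. -/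

noncomputable section

/-! ### Truncated exponential and logarithm as polynomials -/

/-- In a torsion-free ring a polynomial without constant term is divisible by `X ^ (k + 1)` as soon
as its derivative is divisible by `X ^ k`. -/
theorem X_pow_succ_dvd_of_derivative {R : Type*} [CommRing R] [IsAddTorsionFree R]
    {p : Polynomial R} {k : ℕ} (h0 : p.coeff 0 = 0)
    (h : Polynomial.X ^ k ∣ Polynomial.derivative p) : Polynomial.X ^ (k + 1) ∣ p := by
  rw [Polynomial.X_pow_dvd_iff] at h ⊢
  rintro (_ | i) hi
  · exact h0
  · have h1 := h i (by omega)
    rw [Polynomial.coeff_derivative] at h1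
    have h2 : (i + 1) • p.coeff (i + 1) = (i + 1) • (0 : R) := by
      rw [smul_zero, nsmul_eq_mul, mul_comm]; exact_mod_cast h1
    exact nsmul_right_injective (Nat.succ_ne_zero i) h2

section TruncatedSeries

variable {S : Type*} [CommRing S] (c : ℕ → S) (n : ℕ)

/-- The exponential series with coefficients `c k = 1 / k!`, truncated after degree `n`. -/
def truncExp : Polynomial S :=
  ∑ k ∈ Finset.range (n + 1), Polynomial.C (c k) * Polynomial.X ^ k

/-- The series of `log (1 + X)`, truncated after degree `n`, where `c k = 1 / k!`. -/
def truncLog : Polynomial S :=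
  ∑ k ∈ Finset.range n,
    Polynomial.C ((-1) ^ k * k.factorial * c (k + 1)) * Polynomial.X ^ (k + 1)

variable {c n} (hc : ∀ k ≤ n, c k * (k.factorial : S) = 1)
include hc

theorem truncExp_eval_zero : (truncExp c n).eval 0 = 1 := by
  have := hc 0 (Nat.zero_le _)
  simp only [Nat.factorial_zero, Nat.cast_one, mul_one] at this
  simp [truncExp, Finset.sum_range_succ', Polynomial.eval_finsetSum, this]

omit hc in
theorem truncLog_eval_zero : (truncLog c n).eval 0 = 0 := by
  simp [truncLog, Polynomial.eval_finsetSum]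

theorem X_dvd_truncExp_sub_one : Polynomial.X ∣ truncExp c n - 1 := by
  rw [Polynomial.X_dvd_iff, Polynomial.coeff_zero_eq_eval_zero]
  simp [truncExp_eval_zero hc]

omit hc in
theorem X_dvd_truncLog : Polynomial.X ∣ truncLog c n := by
  rw [Polynomial.X_dvd_iff, Polynomial.coeff_zero_eq_eval_zero, truncLog_eval_zero]

/-- The equation E' = E, up to the top term lost by truncation. -/
theorem derivative_truncExp : Polynomial.derivative (truncExp c n) =
    truncExp c n - Polynomial.C (c n) * Polynomial.X ^ n := by
  have h1 : truncExp c n - Polynomial.C (c n) * Polynomial.X ^ n =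
      ∑ k ∈ Finset.range n, Polynomial.C (c k) * Polynomial.X ^ k := by
    rw [truncExp, Finset.sum_range_succ, add_sub_cancel_right]
  rw [h1, truncExp, Polynomial.derivative_sum, Finset.sum_range_succ']
  simp only [Polynomial.derivative_C_mul_X_pow, Nat.cast_zero, mul_zero, map_zero, zero_mul,
    add_zero, Nat.add_sub_cancel]
  refine Finset.sum_congr rfl fun k hk => ?_
  rw [Finset.mem_range] at hk
  have e1 := hc k hk.le
  have e2 := hc (k + 1) hk
  rw [Nat.factorial_succ] at e2
  push_cast at e2 ⊢
  congr 2
  linear_combination (c k) * e2 - (c (k + 1) * (k + 1)) * e1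

/-- The equation (1 + X) L' = 1, with the error given by a finite geometric sum. -/
theorem derivative_truncLog : (1 + Polynomial.X) * Polynomial.derivative (truncLog c n) =
    1 - (-Polynomial.X) ^ n := by
  have h1 : Polynomial.derivative (truncLog c n) =
      ∑ k ∈ Finset.range n, (-Polynomial.X : Polynomial S) ^ k := by
    rw [truncLog, Polynomial.derivative_sum]
    refine Finset.sum_congr rfl fun k hk => ?_
    rw [Finset.mem_range] at hk
    have e2 := hc (k + 1) hk
    rw [Nat.factorial_succ] at e2
    push_cast at e2
    rw [Polynomial.derivative_C_mul_X_pow, Nat.add_sub_cancel, neg_pow (Polynomial.X : Polynomial S)]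
    have : (-1) ^ k * (k.factorial : S) * c (k + 1) * ((k + 1 : ℕ) : S) = (-1) ^ k := by
      push_cast
      linear_combination (-1) ^ k * e2
    rw [this]
    simp
  have h2 := mul_neg_geom_sum (-Polynomial.X : Polynomial S) n
  rw [h1, ← h2]
  ring

/-- The two differential equations show that the derivative of the difference is divisible by X ^ n.
The constant term vanishes, so torsion-freeness allows integrating once. -/
theorem X_pow_dvd_truncLog_comp [IsAddTorsionFree S] : Polynomial.X ^ (n + 1) ∣
    (truncLog c n).comp (truncExp c n - 1) - Polynomial.X := by
  apply X_pow_succ_dvd_of_derivative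
  · rw [Polynomial.coeff_zero_eq_eval_zero]
    simp [Polynomial.eval_comp, truncExp_eval_zero hc, truncLog_eval_zero]
  · have h := congrArg (fun p => Polynomial.comp p (truncExp c n - 1)) (derivative_truncLog hc)
    simp only [Polynomial.mul_comp, Polynomial.add_comp, Polynomial.one_comp, Polynomial.X_comp,
      Polynomial.sub_comp, Polynomial.pow_comp, Polynomial.neg_comp] at h
    have key : Polynomial.derivative ((truncLog c n).comp (truncExp c n - 1) - Polynomial.X) =
        -(-(truncExp c n - 1)) ^ n - Polynomial.X ^ n * (Polynomial.C (c n) *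
          (Polynomial.derivative (truncLog c n)).comp (truncExp c n - 1)) := by
      rw [Polynomial.derivative_sub, Polynomial.derivative_comp, Polynomial.derivative_sub,
        Polynomial.derivative_one, Polynomial.derivative_X, derivative_truncExp hc]
      linear_combination h
    rw [key]
    refine dvd_sub (dvd_neg.2 (pow_dvd_pow_of_dvd (dvd_neg.2 (X_dvd_truncExp_sub_one hc)) n))
      (dvd_mul_right _ _)

/-- The error w satisfies (1 + X) w' = w modulo X ^ n. Hence divisibility of w by X ^ k passes to
w', and integration gains one power of X at each step until k = n + 1. -/
theorem X_pow_dvd_truncExp_comp [IsAddTorsionFree S] : Polynomial.X ^ (n + 1) ∣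
    (truncExp c n).comp (truncLog c n) - (1 + Polynomial.X) := by
  set w := (truncExp c n).comp (truncLog c n) - (1 + Polynomial.X) with hw
  have h0 : w.coeff 0 = 0 := by
    rw [Polynomial.coeff_zero_eq_eval_zero]
    simp [hw, Polynomial.eval_comp, truncExp_eval_zero hc, truncLog_eval_zero]
  have hd : (1 + Polynomial.X) * Polynomial.derivative w = w -
      (Polynomial.C (c n) * (truncLog c n) ^ n * (1 - (-Polynomial.X) ^ n) +
        (truncExp c n).comp (truncLog c n) * (-Polynomial.X) ^ n) := by
    have h := derivative_truncLog hc
    rw [hw, Polynomial.derivative_sub, Polynomial.derivative_comp, Polynomial.derivative_add,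
        Polynomial.derivative_one, Polynomial.derivative_X, derivative_truncExp hc,
        Polynomial.sub_comp, Polynomial.mul_comp, Polynomial.C_comp, Polynomial.X_pow_comp]
    linear_combination ((truncExp c n).comp (truncLog c n) -
      Polynomial.C (c n) * (truncLog c n) ^ n) * h
  have main : ∀ k ≤ n + 1, Polynomial.X ^ k ∣ w := by
    intro k
    induction k with
    | zero => intro _; simp
    | succ k ih =>
      intro hk
      have hkn : k ≤ n := by omega
      refine X_pow_succ_dvd_of_derivative h0 ?_
      -- The factor 1 + X in front of the derivative is cancelled by coprimality to X.
      have hcop : IsCoprime (Polynomial.X ^ k : Polynomial S) (1 + Polynomial.X) :=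
        IsCoprime.pow_left ⟨-1, 1, by ring⟩
      refine hcop.dvd_of_dvd_mul_left ?_
      rw [hd]
      have e1 : (Polynomial.X : Polynomial S) ^ k ∣ (truncLog c n) ^ n :=
        (pow_dvd_pow _ hkn).trans (pow_dvd_pow_of_dvd X_dvd_truncLog n)
      have e2 : (Polynomial.X : Polynomial S) ^ k ∣ (-Polynomial.X) ^ n :=
        (pow_dvd_pow _ hkn).trans (pow_dvd_pow_of_dvd (dvd_neg.2 dvd_rfl) n)
      exact dvd_sub (ih (by omega)) (dvd_add ((e1.mul_left _).mul_right _) (e2.mul_left _))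
  exact main _ le_rfl

end TruncatedSeries

/-! ### Exponential and logarithm of nilpotent elements and of matrices -/

section AlgebraExp

variable {S R A : Type*} [CommRing S] [CommRing R] [Ring A] [Algebra R A] (c : ℕ → S) (n : ℕ)
  (ι : S →+* R)

/-- The truncated exponential of an element of an `R`-algebra. -/
def algExp (a : A) : A := Polynomial.aeval a ((truncExp c n).map ι)

/-- The truncated logarithm of an element of an `R`-algebra. -/
def algLog (a : A) : A := Polynomial.aeval (a - 1) ((truncLog c n).map ι)

variable {c n}

theorem aeval_eq_zero_of_X_pow_dvd {p : Polynomial S} {k : ℕ} (hp : Polynomial.X ^ k ∣ p)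
    {a : A} (ha : a ^ k = 0) : Polynomial.aeval a (p.map ι) = 0 := by
  obtain ⟨q, rfl⟩ := hp
  simp [ha]

theorem algExp_eq_sum (a : A) : algExp c n ι a = ∑ k ∈ Finset.range (n + 1), ι (c k) • a ^ k := by
  simp [algExp, truncExp, Polynomial.map_sum, Algebra.smul_def]

variable (hc : ∀ k ≤ n, c k * (k.factorial : S) = 1)
include hc

theorem exists_algExp_eq (a : A) : ∃ u, algExp c n ι a = 1 + a * u ∧ Commute a u := by
  obtain ⟨q, hq⟩ := X_dvd_truncExp_sub_one hc
  refine ⟨Polynomial.aeval a (q.map ι), ?_, ?_⟩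
  · rw [algExp, sub_eq_iff_eq_add'.1 hq]
    simp
  · have := Polynomial.aeval_X (R := R) a
    nth_rewrite 1 [← this]
    exact Commute.map (Commute.all _ _) (Polynomial.aeval a)

omit hc in
theorem exists_algLog_eq (a : A) :
    ∃ u, algLog c n ι a = (a - 1) * u ∧ Commute (a - 1) u := by
  obtain ⟨q, hq⟩ := X_dvd_truncLog (c := c) (n := n)
  refine ⟨Polynomial.aeval (a - 1) (q.map ι), ?_, ?_⟩
  · rw [algLog, hq]
    simp
  · have := Polynomial.aeval_X (R := R) (a - 1)
    nth_rewrite 1 [← this]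
    exact Commute.map (Commute.all _ _) (Polynomial.aeval (a - 1))

/-- Only S has to be torsion-free: the congruence is proved over S and then transported along `ι`.
So R may have positive characteristic, as the finite fields do. -/
theorem algLog_algExp [IsAddTorsionFree S] {a : A} (ha : a ^ (n + 1) = 0) :
    algLog c n ι (algExp c n ι a) = a := by
  have h := aeval_eq_zero_of_X_pow_dvd ι (X_pow_dvd_truncLog_comp hc) ha
  rw [Polynomial.map_sub, Polynomial.map_comp, map_sub, Polynomial.aeval_comp] at h
  simpa [algLog, algExp, sub_eq_zero] using h

theorem algExp_algLog [IsAddTorsionFree S] {a : A} (ha : (a - 1) ^ (n + 1) = 0) :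
    algExp c n ι (algLog c n ι a) = a := by
  have h := aeval_eq_zero_of_X_pow_dvd ι (X_pow_dvd_truncExp_comp hc) ha
  rw [Polynomial.map_sub, Polynomial.map_comp, map_sub, Polynomial.aeval_comp, sub_eq_zero] at h
  simpa [algLog, algExp] using h

omit hc in
theorem algLog_pow_eq_zero {a : A} (ha : (a - 1) ^ (n + 1) = 0) :
    algLog c n ι a ^ (n + 1) = 0 := by
  obtain ⟨u, hu, hcomm⟩ := exists_algLog_eq (c := c) (n := n) ι a
  rw [hu, hcomm.mul_pow, ha, zero_mul]

omit hc in
theorem commute_algLog {a b : A} (h : Commute a b) :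
    Commute (algLog c n ι a) (algLog c n ι b) := by
  have h1 : ∀ {x y : A} (p : Polynomial R), Commute x y → Commute (Polynomial.aeval x p) y := by
    intro x y p hxy
    induction p using Polynomial.induction_on' with
    | add p q hp hq => rw [map_add]; exact hp.add_left hq
    | monomial k r =>
      rw [Polynomial.aeval_monomial]
      exact Commute.mul_left (Algebra.commutes r y) (hxy.pow_left k)
  have h' : Commute (a - 1) (b - 1) :=
    (h.sub_left (Commute.one_left b)).sub_right (Commute.one_right _)
  exact h1 _ (h1 _ h'.symm).symm

/-- Each of a, b is recovered from its exponential as a polynomial expression, and polynomials in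
commuting elements commute. -/
theorem commute_of_commute_algExp [IsAddTorsionFree S] {a b : A} (ha : a ^ (n + 1) = 0)
    (hb : b ^ (n + 1) = 0) (h : Commute (algExp c n ι a) (algExp c n ι b)) : Commute a b := by
  have := commute_algLog (c := c) (n := n) ι h
  rwa [algLog_algExp ι hc ha, algLog_algExp ι hc hb] at this

end AlgebraExp

section MatrixExp

variable {S R R' : Type*} [CommRing S] [CommRing R] [CommRing R'] (c : ℕ → S) (n : ℕ)
  (ι : S →+* R) {m : ℕ}

theorem aeval_matrix_map_ringHom (φ : R →+* R') (p : Polynomial S) (a : Matrix (Fin m) (Fin m) R) :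
    (Polynomial.aeval a (p.map ι)).map φ = Polynomial.aeval (a.map φ) (p.map (φ.comp ι)) := by
  change φ.mapMatrix _ = Polynomial.aeval (φ.mapMatrix a) _
  induction p using Polynomial.induction_on' with
  | add p q hp hq => simp only [Polynomial.map_add, map_add, hp, hq]
  | monomial k r =>
    simp only [Polynomial.map_monomial, Polynomial.aeval_monomial, map_mul, map_pow]
    congr 1
    ext i j
    simp [Matrix.algebraMap_matrix_apply, apply_ite φ]

theorem algExp_map (φ : R →+* R') (a : Matrix (Fin m) (Fin m) R) :
    (algExp c n ι a).map φ = algExp c n (φ.comp ι) (a.map φ) :=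
  aeval_matrix_map_ringHom ι φ _ a

theorem algLog_map (φ : R →+* R') (a : Matrix (Fin m) (Fin m) R) :
    (algLog c n ι a).map φ = algLog c n (φ.comp ι) (a.map φ) := by
  rw [algLog, aeval_matrix_map_ringHom, algLog, Matrix.map_sub _ (by simp),
    Matrix.map_one _ (map_zero _) (map_one _)]

/-- A strictly upper triangular `n × n` matrix is nilpotent. -/
theorem pow_eq_zero_of_strictUpper {a : Matrix (Fin m) (Fin m) R}
    (ha : ∀ i j, j ≤ i → a i j = 0) : a ^ m = 0 := by
  -- The characteristic polynomial is X ^ m, so Cayley–Hamilton gives the claim.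
  have h1 := Matrix.charpoly_of_isUpperTriangular a (fun i j hij => ha i j (le_of_lt hij))
  have h2 := Matrix.aeval_self_charpoly a
  rw [h1] at h2
  simpa [fun i => ha i i le_rfl] using h2

end MatrixExp

/-! ### Affine charts and the groups they parametrize -/

/-- A closed embedding of affine `e`-space into the space of `m × m` matrices over `S`, with a
polynomial left inverse. -/
structure AffineChart (S : Type) [CommRing S] (e m : ℕ) where
  mat : Matrix (Fin m) (Fin m) (MvPolynomial (Fin e) S)
  coord : Fin e → MvPolynomial (Fin m × Fin m) S
  left_inv : ∀ i, MvPolynomial.aeval (fun p : Fin m × Fin m => mat p.1 p.2) (coord i) =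
    MvPolynomial.X i

/-- Ring homomorphisms commute with evaluation of polynomials. -/
theorem map_eval₂Hom_apply {σ S R R' : Type*} [CommRing S] [CommRing R] [CommRing R']
    (ι : S →+* R) (φ : R →+* R') (x : σ → R) (p : MvPolynomial σ S) :
    φ (MvPolynomial.eval₂Hom ι x p) = MvPolynomial.eval₂Hom (φ.comp ι) (fun i => φ (x i)) p := by
  have := MvPolynomial.map_eval₂Hom ι x φ p
  simpa using this

theorem aeval_eq_eval₂Hom {σ S R : Type*} [CommRing S] [CommRing R] [Algebra S R]
    (x : σ → R) (p : MvPolynomial σ S) :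
    MvPolynomial.aeval x p = MvPolynomial.eval₂Hom (algebraMap S R) x p := rfl

theorem aeval_matrix_map_algHom {S R R' : Type*} [CommRing S] [CommRing R] [CommRing R']
    [Algebra S R] [Algebra S R'] {m : ℕ} (φ : R →ₐ[S] R') (A : Matrix (Fin m) (Fin m) R)
    (f : MvPolynomial (Fin m × Fin m) S) :
    MvPolynomial.aeval (fun p : Fin m × Fin m => (A.map φ) p.1 p.2) f =
      φ (MvPolynomial.aeval (fun p : Fin m × Fin m => A p.1 p.2) f) :=
  (MvPolynomial.comp_aeval_apply (fun p : Fin m × Fin m => A p.1 p.2) φ f).symm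

theorem MatrixZero.map_algHom {S R R' : Type*} [CommRing S] [CommRing R] [CommRing R']
    [Algebra S R] [Algebra S R'] {m : ℕ} {I : Ideal (MvPolynomial (Fin m × Fin m) S)}
    {A : Matrix (Fin m) (Fin m) R} (h : MatrixZero I A) (φ : R →ₐ[S] R') :
    MatrixZero I (A.map φ) := fun f hf => by
  rw [aeval_matrix_map_algHom, h f hf, map_zero]

namespace AffineChart

variable {S : Type} [CommRing S] {e m : ℕ} (c : AffineChart S e m)
  {R R' : Type*} [CommRing R] [CommRing R']

/-- The matrix with coordinates `x`. -/
def pt (ι : S →+* R) (x : Fin e → R) : Matrix (Fin m) (Fin m) R :=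
  c.mat.map (MvPolynomial.eval₂Hom ι x)

/-- The coordinates of a matrix. -/
def coords (ι : S →+* R) (A : Matrix (Fin m) (Fin m) R) : Fin e → R :=
  fun i => MvPolynomial.eval₂Hom ι (fun p : Fin m × Fin m => A p.1 p.2) (c.coord i)

theorem pt_map (ι : S →+* R) (φ : R →+* R') (x : Fin e → R) :
    (c.pt ι x).map φ = c.pt (φ.comp ι) (fun i => φ (x i)) := by
  ext i j
  exact map_eval₂Hom_apply ι φ x _

theorem coords_map (ι : S →+* R) (φ : R →+* R') (A : Matrix (Fin m) (Fin m) R) (i : Fin e) :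
    φ (c.coords ι A i) = c.coords (φ.comp ι) (A.map φ) i :=
  map_eval₂Hom_apply ι φ _ _

theorem coords_pt (ι : S →+* R) (x : Fin e → R) : c.coords ι (c.pt ι x) = x := by
  ext i
  have h := congrArg (MvPolynomial.eval₂Hom ι x) (c.left_inv i)
  rw [aeval_eq_eval₂Hom, map_eval₂Hom_apply] at h
  have h1 : (MvPolynomial.eval₂Hom ι x).comp (algebraMap S (MvPolynomial (Fin e) S)) = ι := by
    ext s
    simp [MvPolynomial.algebraMap_eq]
  rw [h1, MvPolynomial.eval₂Hom_X'] at h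
  exact h

theorem pt_injective (ι : S →+* R) : Function.Injective (c.pt ι) :=
  Function.LeftInverse.injective (c.coords_pt ι)

variable (j : S →+* ℚ)

/-- The matrix with generic coordinates over `ℚ`. -/
def genericPt : Matrix (Fin m) (Fin m) (MvPolynomial (Fin e) ℚ) :=
  c.pt (MvPolynomial.C.comp j) MvPolynomial.X

theorem genericPt_map {R : Type*} [CommRing R] [Algebra ℚ R] (x : Fin e → R) :
    (c.genericPt j).map (MvPolynomial.aeval x : MvPolynomial (Fin e) ℚ →ₐ[ℚ] R) =
      c.pt ((algebraMap ℚ R).comp j) x := by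
  have := c.pt_map (MvPolynomial.C.comp j)
    (MvPolynomial.aeval x : MvPolynomial (Fin e) ℚ →ₐ[ℚ] R).toRingHom MvPolynomial.X
  have h1 : (MvPolynomial.aeval x : MvPolynomial (Fin e) ℚ →ₐ[ℚ] R).toRingHom.comp
      (MvPolynomial.C.comp j) = (algebraMap ℚ R).comp j := by
    ext s
    simp
  rw [h1] at this
  simpa [genericPt] using this

/-- The comorphism of the chart over `ℚ`. -/
def comorphism : MvPolynomial (Fin m × Fin m) ℚ →ₐ[ℚ] MvPolynomial (Fin e) ℚ :=
  MvPolynomial.aeval fun p : Fin m × Fin m => c.genericPt j p.1 p.2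

/-- The vanishing ideal of the image of the chart over `ℚ`. -/
def ideal : Ideal (MvPolynomial (Fin m × Fin m) ℚ) := RingHom.ker (c.comorphism j)

theorem mem_ideal {f : MvPolynomial (Fin m × Fin m) ℚ} : f ∈ c.ideal j ↔
    MvPolynomial.aeval (fun p : Fin m × Fin m => c.genericPt j p.1 p.2) f = 0 := Iff.rfl

theorem aeval_pt {R : Type*} [CommRing R] [Algebra ℚ R] (x : Fin e → R)
    (f : MvPolynomial (Fin m × Fin m) ℚ) :
    MvPolynomial.aeval (fun p : Fin m × Fin m => c.pt ((algebraMap ℚ R).comp j) x p.1 p.2) f =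
      MvPolynomial.aeval x (MvPolynomial.aeval
        (fun p : Fin m × Fin m => c.genericPt j p.1 p.2) f) := by
  rw [← c.genericPt_map]
  exact aeval_matrix_map_algHom _ _ f

/-- The `(p, q)` entry of the identity "every point of the image is determined by its
coordinates". -/
def relation (p : Fin m × Fin m) : MvPolynomial (Fin m × Fin m) S :=
  MvPolynomial.X p - c.pt MvPolynomial.C (c.coords MvPolynomial.C
    (Matrix.of fun i j => MvPolynomial.X (i, j))) p.1 p.2

theorem eval_relation (ι : S →+* R) (A : Matrix (Fin m) (Fin m) R) (p : Fin m × Fin m) :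
    MvPolynomial.eval₂Hom ι (fun p : Fin m × Fin m => A p.1 p.2) (c.relation p) =
      A p.1 p.2 - c.pt ι (c.coords ι A) p.1 p.2 := by
  have h1 : (MvPolynomial.eval₂Hom ι (fun p : Fin m × Fin m => A p.1 p.2)).comp MvPolynomial.C
      = ι := by
    ext s; simp
  have h2 : (Matrix.of fun i j => (MvPolynomial.X (i, j) : MvPolynomial (Fin m × Fin m) S)).map
      (MvPolynomial.eval₂Hom ι (fun p : Fin m × Fin m => A p.1 p.2)) = A := by
    ext i j; simp
  have h3 := c.pt_map MvPolynomial.C (MvPolynomial.eval₂Hom ι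
    (fun p : Fin m × Fin m => A p.1 p.2)) (c.coords MvPolynomial.C
    (Matrix.of fun i j => MvPolynomial.X (i, j)))
  simp only [c.coords_map, h1, h2] at h3
  rw [relation, map_sub, ← h3]
  simp

/-- The generic point of the chart has its own coordinates, by the left inverse, and so satisfies
the relations. -/
theorem map_relation_mem_ideal (p : Fin m × Fin m) :
    MvPolynomial.map j (c.relation p) ∈ c.ideal j := by
  rw [mem_ideal, aeval_eq_eval₂Hom, MvPolynomial.coe_eval₂Hom, MvPolynomial.eval₂_map,
    ← MvPolynomial.coe_eval₂Hom, eval_relation, sub_eq_zero]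
  have h : c.coords ((algebraMap ℚ (MvPolynomial (Fin e) ℚ)).comp j) (c.genericPt j) =
      MvPolynomial.X := c.coords_pt _ _
  rw [h]
  rfl

/-- The relations force a zero A of the ideal to be the chart point with the coordinates of A; no
image closure enlarges the set of points. -/
theorem matrixZero_ideal_iff {R : Type*} [CommRing R] [Algebra ℚ R]
    (A : Matrix (Fin m) (Fin m) R) :
    MatrixZero (c.ideal j) A ↔ ∃ x, c.pt ((algebraMap ℚ R).comp j) x = A := by
  constructor
  · intro h
    refine ⟨c.coords ((algebraMap ℚ R).comp j) A, ?_⟩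
    ext i k
    have := h _ (c.map_relation_mem_ideal j (i, k))
    rw [aeval_eq_eval₂Hom, MvPolynomial.coe_eval₂Hom, MvPolynomial.eval₂_map,
      ← MvPolynomial.coe_eval₂Hom, eval_relation, sub_eq_zero] at this
    exact this.symm
  · rintro ⟨x, rfl⟩ f hf
    rw [aeval_pt, (c.mem_ideal j).1 hf, map_zero]

/-- An ideal whose points are exactly the image of the chart is the ideal of the chart. -/
theorem ideal_eq {I : Ideal (MvPolynomial (Fin m × Fin m) ℚ)}
    (h1 : MatrixZero I (c.genericPt j))
    (h2 : ∀ (R : Type) [CommRing R] [Algebra ℚ R] (A : Matrix (Fin m) (Fin m) R),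
      MatrixZero I A → ∃ x, c.pt ((algebraMap ℚ R).comp j) x = A) : I = c.ideal j := by
  refine le_antisymm (fun f hf => h1 f hf) fun f hf => ?_
  have key : ∀ g : MvPolynomial (Fin m × Fin m) ℚ,
      MvPolynomial.aeval (fun p : Fin m × Fin m => Ideal.Quotient.mk I (MvPolynomial.X (p.1, p.2)))
        g = Ideal.Quotient.mk I g := by
    intro g
    have : MvPolynomial.aeval (fun p : Fin m × Fin m =>
        Ideal.Quotient.mk I (MvPolynomial.X (p.1, p.2))) = Ideal.Quotient.mkₐ ℚ I := by
      ext p; simp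
    rw [this]; rfl
  -- The tautological matrix over ℚ[X]/I is a point of I, hence of the chart. A polynomial in the
  -- chart ideal therefore vanishes on it, which means that it lies in I.
  obtain ⟨x, hx⟩ := h2 (MvPolynomial (Fin m × Fin m) ℚ ⧸ I)
    (Matrix.of fun i k => Ideal.Quotient.mk I (MvPolynomial.X (i, k)))
    (fun g hg => (key g).trans (Ideal.Quotient.eq_zero_iff_mem.2 hg))
  refine Ideal.Quotient.eq_zero_iff_mem.1 ((key f).symm.trans ?_)
  exact ((c.matrixZero_ideal_iff j _).2 ⟨x, hx⟩) f hf

theorem comorphism_surjective : Function.Surjective (c.comorphism j) := by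
  rw [← AlgHom.range_eq_top, eq_top_iff, ← MvPolynomial.adjoin_range_X]
  refine Algebra.adjoin_le ?_
  rintro _ ⟨i, rfl⟩
  refine ⟨MvPolynomial.map j (c.coord i), ?_⟩
  change MvPolynomial.aeval (fun p : Fin m × Fin m => c.genericPt j p.1 p.2) _ = _
  rw [aeval_eq_eval₂Hom, MvPolynomial.coe_eval₂Hom, MvPolynomial.eval₂_map,
    ← MvPolynomial.coe_eval₂Hom]
  exact congrFun (c.coords_pt (MvPolynomial.C.comp j) MvPolynomial.X) i

/-- The comorphism is surjective because the coordinates are polynomial, so the coordinate ring is a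
polynomial ring in e variables. -/
theorem dim_eq (K : UnitriangularAlgGroup m) (hK : K.ideal = c.ideal j) : K.dim = e := by
  have e1 : K.CoordRing ≃+* MvPolynomial (Fin e) ℚ :=
    (Ideal.quotEquivOfEq hK).trans
      (RingHom.quotientKerEquivOfSurjective (f := (c.comorphism j).toRingHom)
        (c.comorphism_surjective j))
  rw [UnitriangularAlgGroup.dim, ringKrullDim_eq_of_ringEquiv e1,
    MvPolynomial.ringKrullDim_of_isNoetherianRing]
  simp

/-- A polynomial over a ring of fractions of `ℤ` times a suitable unit is integral. -/
theorem exists_unit_mul_eq_map {σ : Type*} (hS : ∀ a : S, ∃ N k : ℤ, IsUnit (N : S) ∧ N * a = k)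
    (f : MvPolynomial σ S) : ∃ (N : ℤ) (g : MvPolynomial σ ℤ), IsUnit (N : S) ∧
      MvPolynomial.map (Int.castRingHom S) g = MvPolynomial.C (N : S) * f := by
  induction f using MvPolynomial.induction_on with
  | C a =>
    obtain ⟨N, k, hN, hk⟩ := hS a
    refine ⟨N, MvPolynomial.C k, hN, ?_⟩
    rw [MvPolynomial.map_C, ← MvPolynomial.C_mul, hk]
    simp
  | add p q hp hq =>
    obtain ⟨N, g, hN, hg⟩ := hp
    obtain ⟨N', g', hN', hg'⟩ := hq
    refine ⟨N * N', MvPolynomial.C N' * g + MvPolynomial.C N * g', by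
      push_cast; exact hN.mul hN', ?_⟩
    rw [map_add, map_mul, map_mul, hg, hg', MvPolynomial.map_C, MvPolynomial.map_C]
    simp only [eq_intCast, Int.cast_mul, MvPolynomial.C_mul]
    ring
  | mul_X p i hp =>
    obtain ⟨N, g, hN, hg⟩ := hp
    exact ⟨N, g * MvPolynomial.X i, hN, by rw [map_mul, hg, MvPolynomial.map_X, mul_assoc]⟩

/-- Over a ring receiving a homomorphism from the base ring of the chart, the points of the
closure over `ℤ` are still given by the chart. -/
theorem matrixZero_intIdeal_iff (hj : Function.Injective j)
    (hS : ∀ a : S, ∃ N k : ℤ, IsUnit (N : S) ∧ N * a = k)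
    (K : UnitriangularAlgGroup m) (hK : K.ideal = c.ideal j) (ι : S →+* R)
    (A : Matrix (Fin m) (Fin m) R) :
    MatrixZero K.intIdeal A ↔ ∃ x, c.pt ι x = A := by
  constructor
  · intro h
    refine ⟨c.coords ι A, ?_⟩
    ext i k
    -- The relations have coefficients in S. Multiplied by an integer that is a unit in S they
    -- become integral elements of the vanishing ideal, and the unit can be cancelled after
    -- evaluation in R.
    obtain ⟨N, g, hN, hg⟩ := exists_unit_mul_eq_map hS (c.relation (i, k))
    have hgI : g ∈ K.intIdeal := by
      change MvPolynomial.map (Int.castRingHom ℚ) g ∈ K.ideal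
      have h1 : Int.castRingHom ℚ = j.comp (Int.castRingHom S) := Subsingleton.elim _ _
      rw [h1, ← MvPolynomial.map_map, hg, map_mul, hK]
      exact Ideal.mul_mem_left _ _ (c.map_relation_mem_ideal j _)
    have h0 := h g hgI
    have h2 : algebraMap ℤ R = ι.comp (Int.castRingHom S) := Subsingleton.elim _ _
    rw [aeval_eq_eval₂Hom, h2, MvPolynomial.coe_eval₂Hom, ← MvPolynomial.eval₂_map, hg,
      ← MvPolynomial.coe_eval₂Hom, map_mul, eval_relation] at h0
    have hu : IsUnit (ι (N : S)) := hN.map ι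
    have h3 : A i k - c.pt ι (c.coords ι A) i k = 0 := by
      refine (hu.mul_right_eq_zero).1 ?_
      simpa using h0
    exact (sub_eq_zero.1 h3).symm
  · rintro ⟨x, rfl⟩ f hf
    have hf' : MvPolynomial.map (Int.castRingHom ℚ) f ∈ c.ideal j := hK ▸ hf
    -- Since `j` is injective, vanishing on the chart over ℚ already holds identically over S; the
    -- coordinates can then be specialised along `ι`.
    have e1 : MvPolynomial.eval₂Hom (Int.castRingHom _)
        (fun p : Fin m × Fin m => c.mat p.1 p.2) f = 0 := by
      apply MvPolynomial.map_injective j hj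
      rw [map_zero, map_eval₂Hom_apply]
      rw [mem_ideal, aeval_eq_eval₂Hom, MvPolynomial.coe_eval₂Hom, MvPolynomial.eval₂_map,
        ← MvPolynomial.coe_eval₂Hom] at hf'
      refine Eq.trans ?_ hf'
      have hmap : ∀ p : MvPolynomial (Fin e) S, MvPolynomial.map j p =
          MvPolynomial.eval₂Hom (MvPolynomial.C.comp j) MvPolynomial.X p := fun p => by
        have : MvPolynomial.map (σ := Fin e) j =
            MvPolynomial.eval₂Hom (MvPolynomial.C.comp j) MvPolynomial.X := by
          ext <;> simp
        rw [this]
      simp only [hmap]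
      congr 2
      exact Subsingleton.elim _ _
    have e2 := congrArg (MvPolynomial.eval₂Hom ι x) e1
    rw [map_zero, map_eval₂Hom_apply] at e2
    refine Eq.trans ?_ e2
    rw [aeval_eq_eval₂Hom]
    congr 2
    exact Subsingleton.elim _ _

/-- The algebraic group that is the image of a chart. -/
def toGroup
    (lower : ∀ i k : Fin m, k < i → c.genericPt j i k = 0)
    (diag : ∀ i : Fin m, c.genericPt j i i = 1)
    (one : ∀ (R : Type) [CommRing R] [Algebra ℚ R],
      ∃ x, c.pt ((algebraMap ℚ R).comp j) x = 1)
    (mul : ∀ (R : Type) [CommRing R] [Algebra ℚ R] (x y : Fin e → R),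
      ∃ z, c.pt ((algebraMap ℚ R).comp j) z =
        c.pt ((algebraMap ℚ R).comp j) x * c.pt ((algebraMap ℚ R).comp j) y)
    (inv : ∀ (R : Type) [CommRing R] [Algebra ℚ R] (x : Fin e → R),
      ∃ z, c.pt ((algebraMap ℚ R).comp j) x * c.pt ((algebraMap ℚ R).comp j) z = 1) :
    UnitriangularAlgGroup m where
  ideal := c.ideal j
  lower_mem := fun i k hik => by rw [mem_ideal]; simpa using lower i k hik
  diag_mem := fun i => by rw [mem_ideal]; simp [diag i]
  one_mem := fun R _ _ => (c.matrixZero_ideal_iff j _).2 (one R)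
  mul_mem := fun R _ _ A B hA hB => by
    rw [matrixZero_ideal_iff] at *
    obtain ⟨x, rfl⟩ := hA
    obtain ⟨y, rfl⟩ := hB
    exact mul R x y
  inv_mem := fun R _ _ A B hAB hA => by
    rw [matrixZero_ideal_iff] at *
    obtain ⟨x, rfl⟩ := hA
    obtain ⟨z, hz⟩ := inv R x
    refine ⟨z, ?_⟩
    rw [← one_mul (c.pt _ z), ← mul_eq_one_comm.1 hAB, mul_assoc, hz, mul_one]

end AffineChart

/-! ### Dual numbers and first-order deformations -/

section DualNumbers

variable {R : Type*} [CommRing R] {m : ℕ}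

/-- Taylor expansion of first order over the dual numbers. -/
theorem aeval_inl_add_inr {σ S : Type*} [Fintype σ] [CommRing S] [Algebra S R]
    (x y : σ → R) (f : MvPolynomial σ S) :
    MvPolynomial.aeval (fun p => (TrivSqZeroExt.inl (x p) + TrivSqZeroExt.inr (y p) :
        DualNumber R)) f =
      TrivSqZeroExt.inl (MvPolynomial.aeval x f) +
        TrivSqZeroExt.inr (∑ p, MvPolynomial.aeval x (MvPolynomial.pderiv p f) * y p) := by
  classical
  induction f using MvPolynomial.induction_on with
  | C a => simp [TrivSqZeroExt.algebraMap_eq_inl']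
  | add p q hp hq =>
    simp only [map_add, hp, hq, add_mul, Finset.sum_add_distrib, TrivSqZeroExt.inl_add,
      TrivSqZeroExt.inr_add]
    ring
  | mul_X p i hp =>
    rw [map_mul, hp, MvPolynomial.aeval_X]
    simp only [Derivation.leibniz, MvPolynomial.pderiv_X, map_add, smul_eq_mul, map_mul,
      MvPolynomial.aeval_X, add_mul, Finset.sum_add_distrib]
    ext
    · simp
    · simp only [TrivSqZeroExt.snd_mul, TrivSqZeroExt.fst_add, TrivSqZeroExt.snd_add,
        TrivSqZeroExt.fst_inl, TrivSqZeroExt.fst_inr, TrivSqZeroExt.snd_inl,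
        TrivSqZeroExt.snd_inr, add_zero, zero_add, smul_eq_mul, MulOpposite.smul_eq_mul_unop,
        MulOpposite.unop_op, Finset.sum_mul]
      have h1 : ∑ k, MvPolynomial.aeval x p * MvPolynomial.aeval x
          (Pi.single (M := fun _ => MvPolynomial σ S) k 1 i) * y k =
          MvPolynomial.aeval x p * y i := by
        rw [Finset.sum_eq_single i]
        · simp
        · intro j _ hj
          simp [hj.symm]
        · simp
      rw [h1, zero_mul, zero_mul, add_zero, zero_add]
      congr 1
      exact Finset.sum_congr rfl fun _ _ => by ring

/-- The matrix `ε a` over the dual numbers. -/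
def epsMat (a : Matrix (Fin m) (Fin m) R) : Matrix (Fin m) (Fin m) (DualNumber R) :=
  a.map TrivSqZeroExt.inr

theorem fst_epsMat (a : Matrix (Fin m) (Fin m) R) (i j : Fin m) :
    TrivSqZeroExt.fst (epsMat a i j) = 0 := rfl

theorem snd_epsMat (a : Matrix (Fin m) (Fin m) R) (i j : Fin m) :
    TrivSqZeroExt.snd (epsMat a i j) = a i j := rfl

theorem epsMat_neg (a : Matrix (Fin m) (Fin m) R) : epsMat (-a) = -epsMat a := by
  ext i j
  · simp [fst_epsMat]
  · simp [snd_epsMat]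

theorem map_inl_mul_epsMat (a b : Matrix (Fin m) (Fin m) R) :
    a.map (TrivSqZeroExt.inlHom R R) * epsMat b = epsMat (a * b) := by
  ext i j
  · simp [Matrix.mul_apply, TrivSqZeroExt.fst_sum, fst_epsMat]
  · simp [Matrix.mul_apply, TrivSqZeroExt.snd_sum, snd_epsMat, fst_epsMat]

theorem epsMat_mul_map_inl (a b : Matrix (Fin m) (Fin m) R) :
    epsMat a * b.map (TrivSqZeroExt.inlHom R R) = epsMat (a * b) := by
  ext i j
  · simp [Matrix.mul_apply, TrivSqZeroExt.fst_sum, fst_epsMat]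
  · simp [Matrix.mul_apply, TrivSqZeroExt.snd_sum, snd_epsMat, fst_epsMat]

theorem epsMat_mul_epsMat (a b : Matrix (Fin m) (Fin m) R) : epsMat a * epsMat b = 0 := by
  ext i j
  · simp [Matrix.mul_apply, TrivSqZeroExt.fst_sum, fst_epsMat]
  · simp [Matrix.mul_apply, TrivSqZeroExt.snd_sum, fst_epsMat]

theorem epsMat_pow_eq_zero {n : ℕ} {a : Matrix (Fin m) (Fin m) R} (ha : a ^ (n + 1) = 0) :
    epsMat a ^ (n + 1) = 0 := by
  -- For exponent 1 the relation ε² = 0 does not help, but there a itself is zero.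
  rcases n with _ | n
  · have : a = 0 := by simpa using ha
    rw [this]
    ext i j <;> simp [fst_epsMat, snd_epsMat]
  · exact pow_eq_zero_of_le (by omega : 2 ≤ n + 1 + 1) (by rw [sq, epsMat_mul_epsMat])

end DualNumbers

/-! ### The exponential over ℚ-algebras -/

/-- Over a `ℚ`-algebra, a polynomial that vanishes at all natural numbers is zero. -/
theorem polynomial_eq_zero_of_eval_natCast {R : Type*} [CommRing R] [Algebra ℚ R]
    {p : Polynomial R} (h : ∀ k : ℕ, p.eval (k : R) = 0) : p = 0 := by
  ext i
  rw [Polynomial.coeff_zero, ← Module.forall_dual_apply_eq_zero_iff ℚ]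
  intro l
  -- Applying a linear functional to the coefficients yields a rational polynomial with infinitely
  -- many roots.
  set q : Polynomial ℚ :=
    ∑ i ∈ Finset.range (p.natDegree + 1), Polynomial.monomial i (l (p.coeff i)) with hq
  have hq0 : q = 0 := by
    refine Polynomial.eq_zero_of_infinite_isRoot _ ((Set.infinite_range_of_injective
      (Nat.cast_injective (R := ℚ))).mono ?_)
    rintro _ ⟨k, rfl⟩
    have h1 := congrArg l (h k)
    rw [Polynomial.eval_eq_sum_range, map_sum, map_zero] at h1
    refine Eq.trans ?_ h1
    rw [hq, Polynomial.eval_finsetSum]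
    refine Finset.sum_congr rfl fun i _ => ?_
    rw [Polynomial.eval_monomial]
    have : p.coeff i * (k : R) ^ i = ((k : ℚ) ^ i) • p.coeff i := by
      rw [Algebra.smul_def, mul_comm]; simp
    rw [this, map_smul, smul_eq_mul, mul_comm]
  have h2 := congrArg (fun r => Polynomial.coeff r i) hq0
  simp only [hq, Polynomial.finsetSum_coeff, Polynomial.coeff_monomial, Finset.sum_ite_eq',
    Finset.mem_range, Polynomial.coeff_zero] at h2
  split_ifs at h2 with hi
  · exact h2
  · rw [Polynomial.coeff_eq_zero_of_natDegree_lt (by omega), map_zero]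

theorem MatrixZero.map_ringHom {R R' : Type*} [CommRing R] [CommRing R']
    [Algebra ℚ R] [Algebra ℚ R'] {m : ℕ} {I : Ideal (MvPolynomial (Fin m × Fin m) ℚ)}
    {A : Matrix (Fin m) (Fin m) R} (h : MatrixZero I A) (φ : R →+* R') :
    MatrixZero I (A.map φ) := h.map_algHom φ.toRatAlgHom

section RatExp

variable {R : Type*} [CommRing R] [Algebra ℚ R] {n m : ℕ}

/-- The coefficients of the exponential series. -/
def ratCoeff (k : ℕ) : ℚ := (k.factorial : ℚ)⁻¹

theorem ratCoeff_mul (k : ℕ) : ratCoeff k * (k.factorial : ℚ) = 1 :=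
  inv_mul_cancel₀ (by exact_mod_cast k.factorial_ne_zero)

theorem algExp_rat_eq {a : Matrix (Fin m) (Fin m) R} (ha : a ^ (n + 1) = 0) :
    algExp ratCoeff n (algebraMap ℚ R) a = IsNilpotent.exp a := by
  rw [algExp_eq_sum, IsNilpotent.exp_eq_sum ha]
  refine Finset.sum_congr rfl fun k _ => ?_
  rw [algebraMap_smul]
  rfl

theorem algExp_rat_add {a b : Matrix (Fin m) (Fin m) R} (ha : a ^ (n + 1) = 0)
    (hb : b ^ (n + 1) = 0) (hab : (a + b) ^ (n + 1) = 0) (h : Commute a b) :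
    algExp ratCoeff n (algebraMap ℚ R) (a + b) =
      algExp ratCoeff n (algebraMap ℚ R) a * algExp ratCoeff n (algebraMap ℚ R) b := by
  rw [algExp_rat_eq ha, algExp_rat_eq hb, algExp_rat_eq hab,
    IsNilpotent.exp_add_of_commute h ⟨_, ha⟩ ⟨_, hb⟩]

theorem algExp_rat_zero : algExp ratCoeff n (algebraMap ℚ R) (0 : Matrix (Fin m) (Fin m) R) = 1 := by
  rw [algExp_rat_eq (zero_pow n.succ_ne_zero), IsNilpotent.exp_zero]

theorem algExp_rat_natCast_smul {a : Matrix (Fin m) (Fin m) R} (ha : a ^ (n + 1) = 0) (k : ℕ) :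
    algExp ratCoeff n (algebraMap ℚ R) ((k : R) • a) =
      algExp ratCoeff n (algebraMap ℚ R) a ^ k := by
  induction k with
  | zero => rw [Nat.cast_zero, zero_smul, algExp_rat_zero, pow_zero]
  | succ k ih =>
    have h : ∀ r : R, (r • a) ^ (n + 1) = 0 := fun r => by rw [smul_pow, ha, smul_zero]
    have h1 : ((k + 1 : ℕ) : R) • a = (k : R) • a + a := by push_cast; rw [add_smul, one_smul]
    rw [h1, algExp_rat_add (h _) ha (h1 ▸ h _) ((Commute.refl a).smul_left _), ih, pow_succ]

theorem algExp_rat_epsMat {a : Matrix (Fin m) (Fin m) R} (ha : a ^ (n + 1) = 0) :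
    algExp ratCoeff n (algebraMap ℚ (DualNumber R)) (epsMat a) = 1 + epsMat a := by
  have h2 : epsMat a ^ 2 = 0 := by
    rw [sq, epsMat_mul_epsMat]
  have h1 : epsMat a ^ (n + 1) = 0 := epsMat_pow_eq_zero ha
  rw [algExp_rat_eq h1, IsNilpotent.exp_eq_sum h2]
  simp [Finset.sum_range_succ]

end RatExp

/-! ### The Lie algebra of G and its exponential -/

/-- The differential at the identity of the function `f` on matrices. -/
def diffOne {n : ℕ} {R : Type*} [CommRing R] [Algebra ℚ R]
    (f : MvPolynomial (Fin n × Fin n) ℚ) (a : Matrix (Fin n) (Fin n) R) : R :=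
  ∑ p : Fin n × Fin n, MvPolynomial.aeval
    (fun p : Fin n × Fin n => (1 : Matrix (Fin n) (Fin n) ℚ) p.1 p.2)
      (MvPolynomial.pderiv p f) • a p.1 p.2

/-- The differential is linear in the entries of a with rational coefficients, so `l` need not be
multiplicative. This admits ℚ-linear functionals on R and the ε-part of a dual number. -/
theorem diffOne_map {n : ℕ} {R R' : Type*} [CommRing R] [Algebra ℚ R] [CommRing R'] [Algebra ℚ R']
    (f : MvPolynomial (Fin n × Fin n) ℚ) (a : Matrix (Fin n) (Fin n) R) (l : R →ₗ[ℚ] R') :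
    diffOne f (a.map l) = l (diffOne f a) := by
  simp [diffOne, map_sum]

namespace UnitriangularAlgGroup

variable {n : ℕ} (G : UnitriangularAlgGroup n)

/-- The matrix `a` over a `ℚ`-algebra belongs to the Lie algebra of `G`. -/
def IsLie {R : Type*} [CommRing R] [Algebra ℚ R] (a : Matrix (Fin n) (Fin n) R) : Prop :=
  ∀ f ∈ G.ideal, diffOne f a = 0

variable {G}

theorem IsLie.map {R R' : Type*} [CommRing R] [Algebra ℚ R] [CommRing R'] [Algebra ℚ R']
    {a : Matrix (Fin n) (Fin n) R} (h : G.IsLie a) (l : R →ₗ[ℚ] R') : G.IsLie (a.map l) :=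
  fun f hf => by rw [diffOne_map, h f hf, map_zero]

section

variable {R : Type*} [CommRing R] [Algebra ℚ R]

theorem IsLie.add {a b : Matrix (Fin n) (Fin n) R} (ha : G.IsLie a) (hb : G.IsLie b) :
    G.IsLie (a + b) := fun f hf => by
  have h1 := ha f hf
  have h2 := hb f hf
  simp only [diffOne, Matrix.add_apply, smul_add, Finset.sum_add_distrib] at *
  rw [h1, h2, add_zero]

theorem isLie_zero : G.IsLie (0 : Matrix (Fin n) (Fin n) R) := fun f _ => by simp [diffOne]

theorem IsLie.smul {a : Matrix (Fin n) (Fin n) R} (ha : G.IsLie a) (r : R) :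
    G.IsLie (r • a) := fun f hf => by
  have h1 := congrArg (r • ·) (ha f hf)
  simpa only [diffOne, Matrix.smul_apply, Finset.smul_sum, smul_zero, smul_comm r] using h1

theorem IsLie.sum {κ : Type*} (s : Finset κ) {a : κ → Matrix (Fin n) (Fin n) R}
    (ha : ∀ i ∈ s, G.IsLie (a i)) : G.IsLie (∑ i ∈ s, a i) := by
  classical
  induction s using Finset.induction_on with
  | empty => rw [Finset.sum_empty]; exact isLie_zero
  | insert i s hi ih =>
    rw [Finset.sum_insert hi]
    exact (ha i (Finset.mem_insert_self _ _)).add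
      (ih fun k hk => ha k (Finset.mem_insert_of_mem hk))

theorem IsLie.strictUpper {a : Matrix (Fin n) (Fin n) R} (ha : G.IsLie a) (i j : Fin n)
    (hij : j ≤ i) : a i j = 0 := by
  -- Stated through derivatives so that it covers both X_ij and X_ii - 1.
  have key : ∀ f : MvPolynomial (Fin n × Fin n) ℚ, (∀ p, MvPolynomial.pderiv p f =
      MvPolynomial.pderiv p (MvPolynomial.X (i, j))) → f ∈ G.ideal → a i j = 0 := by
    intro f hf hfG
    have h := ha f hfG
    rw [diffOne, Finset.sum_eq_single (i, j)] at h
    · simpa [hf] using h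
    · intro p _ hp
      rw [hf, MvPolynomial.pderiv_X_of_ne hp.symm]
      simp
    · simp
  rcases hij.lt_or_eq with h | rfl
  · exact key _ (fun _ => rfl) (G.lower_mem i j h)
  · exact key _ (fun p => by simp) (G.diag_mem j)

theorem IsLie.pow_eq_zero {a : Matrix (Fin n) (Fin n) R} (ha : G.IsLie a) : a ^ (n + 1) = 0 := by
  rw [pow_succ, pow_eq_zero_of_strictUpper ha.strictUpper, zero_mul]

end

variable {R : Type} [CommRing R] [Algebra ℚ R]

/-- The Lie algebra consists of the first order deformations of the identity. -/
theorem isLie_iff (a : Matrix (Fin n) (Fin n) R) : G.IsLie a ↔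
    MatrixZero G.ideal (1 + epsMat a) := by
  refine forall₂_congr fun f hf => ?_
  have h1 : MvPolynomial.aeval (fun p : Fin n × Fin n => (1 : Matrix (Fin n) (Fin n) R) p.1 p.2) f
      = 0 := G.one_mem R f hf
  have h2 := aeval_inl_add_inr (fun p : Fin n × Fin n => (1 : Matrix (Fin n) (Fin n) R) p.1 p.2)
    (fun p => a p.1 p.2) f
  have h3 : (fun p : Fin n × Fin n => (TrivSqZeroExt.inl ((1 : Matrix (Fin n) (Fin n) R) p.1 p.2) +
      TrivSqZeroExt.inr (a p.1 p.2) : DualNumber R)) = fun p =>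
      (1 + epsMat a) p.1 p.2 := by
    funext p
    simp only [Matrix.add_apply, epsMat, Matrix.map_apply, Matrix.one_apply]
    split_ifs <;> simp
  have h4 : ∑ p, MvPolynomial.aeval (fun p : Fin n × Fin n =>
      (1 : Matrix (Fin n) (Fin n) R) p.1 p.2) (MvPolynomial.pderiv p f) * a p.1 p.2 =
      diffOne f a := by
    refine Finset.sum_congr rfl fun p _ => ?_
    have := aeval_matrix_map_algHom (Algebra.ofId ℚ R) (1 : Matrix (Fin n) (Fin n) ℚ)
      (MvPolynomial.pderiv p f)
    rw [Matrix.map_one _ (map_zero _) (map_one _)] at this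
    rw [this, Algebra.smul_def]
    rfl
  rw [h3, h1, h4] at h2
  rw [h2, TrivSqZeroExt.inl_zero, zero_add]
  exact ⟨fun h => by rw [h, TrivSqZeroExt.inr_zero],
    fun h => TrivSqZeroExt.inr_injective (h.trans (TrivSqZeroExt.inr_zero _).symm)⟩

theorem IsLie.conj {a g h : Matrix (Fin n) (Fin n) R} (ha : G.IsLie a) (hgh : g * h = 1)
    (hg : MatrixZero G.ideal g) (hh : MatrixZero G.ideal h) : G.IsLie (g * a * h) := by
  rw [isLie_iff] at *
  have h1 := G.mul_mem _ _ _ (G.mul_mem _ _ _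
    (hg.map_ringHom (TrivSqZeroExt.inlHom R R)) ha) (hh.map_ringHom (TrivSqZeroExt.inlHom R R))
  rw [mul_add, mul_one, add_mul, ← Matrix.map_mul, hgh, map_inl_mul_epsMat,
    epsMat_mul_map_inl, Matrix.map_one _ (map_zero _) (map_one _)] at h1
  exact h1

/-- Conjugating b by 1 + εa gives b + ε(ab - ba) in the Lie algebra over the dual numbers; the
ε-part is the bracket. -/
theorem IsLie.bracket {a b : Matrix (Fin n) (Fin n) R} (ha : G.IsLie a) (hb : G.IsLie b) :
    G.IsLie (a * b - b * a) := by
  have hinv : (1 + epsMat a) * (1 + epsMat (-a)) = 1 := by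
    rw [mul_add, add_mul, add_mul, epsMat_mul_epsMat, epsMat_neg]
    simp
  have hna : G.IsLie (-a) := by simpa using ha.smul (-1)
  have h1 : G.IsLie ((1 + epsMat a) * b.map (TrivSqZeroExt.inlHom R R) * (1 + epsMat (-a))) :=
    (hb.map (TrivSqZeroExt.inlAlgHom ℚ R R).toLinearMap).conj hinv
      ((isLie_iff a).1 ha) ((isLie_iff _).1 hna)
  have h2 := h1.map ((TrivSqZeroExt.sndHom R R).restrictScalars ℚ)
  rw [mul_add, mul_one, add_mul, one_mul, epsMat_mul_map_inl, add_mul, map_inl_mul_epsMat,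
    epsMat_mul_epsMat, add_zero] at h2
  convert h2 using 1
  ext i j
  simp [snd_epsMat, sub_eq_add_neg, add_comm]

theorem sub_one_strictUpper {A : Matrix (Fin n) (Fin n) R} (hA : MatrixZero G.ideal A)
    (i j : Fin n) (hij : j ≤ i) : (A - 1) i j = 0 := by
  rcases hij.lt_or_eq with h | rfl
  · have := hA _ (G.lower_mem i j h)
    simpa [Matrix.one_apply_ne h.ne'] using this
  · have := hA _ (G.diag_mem j)
    simpa using this

theorem sub_one_pow_eq_zero {A : Matrix (Fin n) (Fin n) R} (hA : MatrixZero G.ideal A) :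
    (A - 1) ^ (n + 1) = 0 := by
  rw [pow_succ, pow_eq_zero_of_strictUpper (sub_one_strictUpper hA), zero_mul]

/-- The one-parameter subgroup `t ↦ exp (t a)`. -/
def oneParam (a : Matrix (Fin n) (Fin n) R) : Matrix (Fin n) (Fin n) (Polynomial R) :=
  algExp ratCoeff n (algebraMap ℚ (Polynomial R)) ((Polynomial.X : Polynomial R) •
    a.map Polynomial.C)

theorem oneParam_map {R' : Type} [CommRing R'] [Algebra ℚ R'] (a : Matrix (Fin n) (Fin n) R)
    (φ : Polynomial R →+* R') : (oneParam a).map φ =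
      algExp ratCoeff n (algebraMap ℚ R') (φ Polynomial.X • a.map (φ.comp Polynomial.C)) := by
  rw [oneParam, algExp_map]
  congr 1
  · exact Subsingleton.elim _ _
  · ext i j
    rw [Matrix.map_apply, Matrix.smul_apply, smul_eq_mul, map_mul]
    rfl

omit [Algebra ℚ R] in
theorem map_pow_eq_zero {R' : Type} [CommRing R'] {a : Matrix (Fin n) (Fin n) R}
    (ha : a ^ (n + 1) = 0) (φ : R →+* R') : a.map φ ^ (n + 1) = 0 := by
  have := congrArg φ.mapMatrix ha
  rwa [map_pow, map_zero] at this

/-- With a = log A, the powers A ^ k = exp (k a) lie in G. An equation of G evaluated at exp (t a)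
is thus a polynomial in t with all natural numbers as roots, so exp (t a) is a point of G over R[t].
Substituting t = ε gives the tangent vector 1 + εa. -/
theorem isLie_algLog {A : Matrix (Fin n) (Fin n) R} (hA : MatrixZero G.ideal A) :
    G.IsLie (algLog ratCoeff n (algebraMap ℚ R) A) := by
  set a := algLog ratCoeff n (algebraMap ℚ R) A with ha
  have hA1 := sub_one_pow_eq_zero hA
  have han : a ^ (n + 1) = 0 := algLog_pow_eq_zero _ hA1
  have hexp : algExp ratCoeff n (algebraMap ℚ R) a = A :=
    algExp_algLog _ (fun k _ => ratCoeff_mul k) hA1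
  have hpow : ∀ k : ℕ, MatrixZero G.ideal (A ^ k) := by
    intro k
    induction k with
    | zero => rw [pow_zero]; exact G.one_mem R
    | succ k ih => rw [pow_succ]; exact G.mul_mem R _ _ ih hA
  have hB : MatrixZero G.ideal (oneParam a) := by
    intro f hf
    refine polynomial_eq_zero_of_eval_natCast fun k => ?_
    have h1 := aeval_matrix_map_algHom (Polynomial.evalRingHom (k : R)).toRatAlgHom (oneParam a) f
    have h2 : (oneParam a).map (Polynomial.evalRingHom (k : R)).toRatAlgHom = A ^ k := by
      have := oneParam_map a (Polynomial.evalRingHom (k : R))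
      have e : (Polynomial.evalRingHom (k : R)).comp Polynomial.C = RingHom.id R := by
        ext; simp
      rw [e, Polynomial.coe_evalRingHom, Polynomial.eval_X] at this
      refine this.trans ?_
      rw [← hexp, ← algExp_rat_natCast_smul han]
      rfl
    rw [h2, hpow k f hf] at h1
    exact h1.symm
  have h3 := hB.map_ringHom (Polynomial.eval₂RingHom (TrivSqZeroExt.inlHom R R)
    (DualNumber.eps : DualNumber R))
  rw [oneParam_map] at h3
  rw [isLie_iff, ← algExp_rat_epsMat han]
  convert h3 using 2
  ext i j <;> simp [fst_epsMat, snd_epsMat]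

/-- If `exp (t a)` is a point of `G` modulo some ideal of `R[t]`, then the derivatives of the
functions `f (exp (t a))`, with `f` vanishing on `G`, belong to this ideal. -/
theorem derivative_oneParam {Q : Type} [CommRing Q] [Algebra ℚ Q] {a : Matrix (Fin n) (Fin n) R}
    (ha : G.IsLie a) (π : Polynomial R →+* Q) (hB : MatrixZero G.ideal ((oneParam a).map π))
    (f : MvPolynomial (Fin n × Fin n) ℚ) (hf : f ∈ G.ideal) :
    π (Polynomial.derivative
      (MvPolynomial.aeval (fun p : Fin n × Fin n => oneParam a p.1 p.2) f)) = 0 := by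
  set a' : Matrix (Fin n) (Fin n) Q := a.map (π.comp Polynomial.C) with ha'_def
  have ha' : G.IsLie a' := ha.map (π.comp Polynomial.C).toRatAlgHom.toLinearMap
  have han' := ha'.pow_eq_zero
  have hprod := G.mul_mem _ _ _ (hB.map_ringHom (TrivSqZeroExt.inlHom Q Q)) ((isLie_iff a').1 ha')
  -- The substitution t ↦ t + ε sends p to p + ε p'. It turns exp (t a) into exp (t a) (1 + εa), a
  -- product of two points of G, so the ε-part p' must vanish for p = f (exp (t a)).
  let θ : Polynomial R →+* DualNumber Q := Polynomial.eval₂RingHom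
    ((TrivSqZeroExt.inlHom Q Q).comp (π.comp Polynomial.C))
    (TrivSqZeroExt.inl (π Polynomial.X) + TrivSqZeroExt.inr (1 : Q))
  have hθC : θ.comp Polynomial.C = (TrivSqZeroExt.inlHom Q Q).comp (π.comp Polynomial.C) := by
    ext r <;> simp [θ]
  have hθX : θ Polynomial.X = TrivSqZeroExt.inl (π Polynomial.X) + TrivSqZeroExt.inr (1 : Q) := by
    simp [θ]
  have hθ : ∀ p, θ p = TrivSqZeroExt.inl (π p) +
      TrivSqZeroExt.inr (π (Polynomial.derivative p)) := by
    intro p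
    induction p using Polynomial.induction_on with
    | C r => simp [θ]
    | add p q hp hq =>
      rw [map_add, hp, hq, map_add, map_add, map_add, TrivSqZeroExt.inl_add, TrivSqZeroExt.inr_add]
      abel
    | monomial i r hi =>
      rw [pow_succ, ← mul_assoc, map_mul, hi, hθX,
        Polynomial.derivative_mul (g := Polynomial.X), Polynomial.derivative_X, mul_one]
      ext
      · simp
      · simp only [TrivSqZeroExt.snd_mul, TrivSqZeroExt.fst_add, TrivSqZeroExt.fst_inl,
          TrivSqZeroExt.fst_inr, TrivSqZeroExt.snd_add, TrivSqZeroExt.snd_inl,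
          TrivSqZeroExt.snd_inr, smul_eq_mul, MulOpposite.smul_eq_mul_unop, MulOpposite.unop_op,
          map_mul, map_add]
        ring
  have hθB : (oneParam a).map θ = ((oneParam a).map π).map (TrivSqZeroExt.inlHom Q Q) *
      (1 + epsMat a') := by
    have e1 : algebraMap ℚ (DualNumber Q) =
        (TrivSqZeroExt.inlHom Q Q).comp (algebraMap ℚ Q) := Subsingleton.elim _ _
    have e2 : θ Polynomial.X • a.map (θ.comp Polynomial.C) =
        (π Polynomial.X • a').map (TrivSqZeroExt.inlHom Q Q) + epsMat a' := by
      rw [hθX, hθC]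
      ext i j
      · simp [fst_epsMat, a']
      · simp [snd_epsMat, a']
    have h1 : (π Polynomial.X • a') ^ (n + 1) = 0 := by rw [smul_pow, han', smul_zero]
    have h2 := map_pow_eq_zero h1 (TrivSqZeroExt.inlHom Q Q)
    have h3 := epsMat_pow_eq_zero han'
    have h4 : ((π Polynomial.X • a').map (TrivSqZeroExt.inlHom Q Q) + epsMat a') ^ (n + 1) = 0 := by
      rw [← e2, smul_pow, map_pow_eq_zero ha.pow_eq_zero (θ.comp Polynomial.C), smul_zero]
    rw [oneParam_map, oneParam_map, ← algExp_rat_epsMat han', algExp_map, ← e1, e2,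
      algExp_rat_add h2 h3 h4]
    rw [Commute, SemiconjBy, map_inl_mul_epsMat, epsMat_mul_map_inl, smul_mul_assoc,
      mul_smul_comm]
  have h1 := aeval_matrix_map_algHom (R' := DualNumber Q) θ.toRatAlgHom (oneParam a) f
  have h2 : (oneParam a).map θ.toRatAlgHom = (oneParam a).map θ := rfl
  rw [h2, hθB, hprod f hf] at h1
  have h3 := congrArg TrivSqZeroExt.snd (h1.trans (hθ _))
  simpa using h3.symm

/-- A formal ODE argument: if exp (t a) is a point of G modulo t ^ k, then f (exp (t a)) has
derivative divisible by t ^ k and zero constant term, hence is divisible by t ^ (k + 1). So it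
vanishes, and t = 1 can be substituted. -/
theorem matrixZero_algExp {a : Matrix (Fin n) (Fin n) R} (ha : G.IsLie a) :
    MatrixZero G.ideal (algExp ratCoeff n (algebraMap ℚ R) a) := by
  have han := ha.pow_eq_zero
  have : IsAddTorsionFree R := IsAddTorsionFree.of_module_rat R
  have main : ∀ k : ℕ, ∀ f ∈ G.ideal, Polynomial.X ^ k ∣
      MvPolynomial.aeval (fun p : Fin n × Fin n => oneParam a p.1 p.2) f := by
    intro k
    induction k with
    | zero => intro f _; simp
    | succ k ih =>
      intro f hf
      refine X_pow_succ_dvd_of_derivative ?_ ?_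
      · have h1 := aeval_matrix_map_algHom (Polynomial.evalRingHom (0 : R)).toRatAlgHom
          (oneParam a) f
        have h2 : (oneParam a).map (Polynomial.evalRingHom (0 : R)).toRatAlgHom = 1 := by
          refine (oneParam_map a (Polynomial.evalRingHom (0 : R))).trans ?_
          rw [Polynomial.coe_evalRingHom, Polynomial.eval_X, zero_smul, algExp_rat_zero]
        rw [h2, G.one_mem R f hf] at h1
        rw [Polynomial.coeff_zero_eq_eval_zero]
        exact h1.symm
      · let Q := Polynomial R ⧸ Ideal.span {(Polynomial.X : Polynomial R) ^ k}
        let π : Polynomial R →+* Q := Ideal.Quotient.mk _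
        have hπ : ∀ p, π p = 0 ↔ Polynomial.X ^ k ∣ p := fun p => by
          rw [Ideal.Quotient.eq_zero_iff_mem, Ideal.mem_span_singleton]
        have hB : MatrixZero G.ideal ((oneParam a).map π) := by
          intro g hg
          have := aeval_matrix_map_algHom π.toRatAlgHom (oneParam a) g
          exact this.trans ((hπ _).2 (ih g hg))
        exact (hπ _).1 (derivative_oneParam ha π hB f hf)
  have hB : MatrixZero G.ideal (oneParam a) := by
    intro f hf
    ext i
    exact Polynomial.X_pow_dvd_iff.1 (main (i + 1) f hf) i (Nat.lt_succ_self i)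
  have h1 := hB.map_ringHom (Polynomial.evalRingHom (1 : R))
  rw [oneParam_map] at h1
  convert h1 using 2
  ext i j
  simp

end UnitriangularAlgGroup

/-! ### Bases of the Lie algebra and the exponential chart -/

section LinearCombinations

variable {S R R' : Type*} [CommRing S] [CommRing R] [CommRing R'] {d m : ℕ}

/-- The linear combination of the matrices `b i` with coefficients `x i`. -/
def linComb (ι : S →+* R) (b : Fin d → Matrix (Fin m) (Fin m) S) (x : Fin d → R) :
    Matrix (Fin m) (Fin m) R := ∑ i, x i • (b i).map ι

/-- The values of the linear forms with coefficient matrices `t i`. -/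
def linCoord (ι : S →+* R) (t : Fin d → Matrix (Fin m) (Fin m) S)
    (a : Matrix (Fin m) (Fin m) R) (i : Fin d) : R :=
  ∑ p : Fin m × Fin m, ι (t i p.1 p.2) * a p.1 p.2

theorem linComb_apply (ι : S →+* R) (b : Fin d → Matrix (Fin m) (Fin m) S) (x : Fin d → R)
    (i k : Fin m) : linComb ι b x i k = ∑ l, x l * ι (b l i k) := by
  simp [linComb, Matrix.sum_apply]

theorem linComb_map (ι : S →+* R) (φ : R →+* R') (b : Fin d → Matrix (Fin m) (Fin m) S)
    (x : Fin d → R) : (linComb ι b x).map φ = linComb (φ.comp ι) b fun i => φ (x i) := by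
  ext i k
  simp [linComb_apply, map_sum]

theorem linComb_add (ι : S →+* R) (b : Fin d → Matrix (Fin m) (Fin m) S) (x y : Fin d → R) :
    linComb ι b (x + y) = linComb ι b x + linComb ι b y := by
  simp [linComb, add_smul, Finset.sum_add_distrib]

theorem linComb_neg (ι : S →+* R) (b : Fin d → Matrix (Fin m) (Fin m) S) (x : Fin d → R) :
    linComb ι b (-x) = -linComb ι b x := by
  simp [linComb, Finset.sum_neg_distrib]

theorem linComb_zero (ι : S →+* R) (b : Fin d → Matrix (Fin m) (Fin m) S) :
    linComb ι b (0 : Fin d → R) = 0 := by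
  simp [linComb]

theorem linCoord_map (ι : S →+* R) (φ : R →+* R') (t : Fin d → Matrix (Fin m) (Fin m) S)
    (a : Matrix (Fin m) (Fin m) R) (i : Fin d) :
    φ (linCoord ι t a i) = linCoord (φ.comp ι) t (a.map φ) i := by
  simp [linCoord, map_sum]

theorem linCoord_linComb {b t : Fin d → Matrix (Fin m) (Fin m) S}
    (h : ∀ i k, ∑ p : Fin m × Fin m, t i p.1 p.2 * b k p.1 p.2 = if i = k then 1 else 0)
    (ι : S →+* R) (x : Fin d → R) : linCoord ι t (linComb ι b x) = x := by
  funext i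
  have h1 : ∀ k, ∑ p : Fin m × Fin m, ι (t i p.1 p.2) * ι (b k p.1 p.2) =
      if i = k then 1 else 0 := by
    intro k
    have := congrArg ι (h i k)
    simpa [map_sum, apply_ite ι] using this
  simp only [linCoord, linComb_apply, Finset.mul_sum]
  rw [Finset.sum_comm]
  have h2 : ∀ k, ∑ p : Fin m × Fin m, ι (t i p.1 p.2) * (x k * ι (b k p.1 p.2)) =
      x k * if i = k then 1 else 0 := by
    intro k
    rw [← h1, Finset.mul_sum]
    exact Finset.sum_congr rfl fun _ _ => by ring
  simp [h2]

theorem linComb_strictUpper {ι : S →+* R} {b : Fin d → Matrix (Fin m) (Fin m) S}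
    (h : ∀ l i k, k ≤ i → b l i k = 0) (x : Fin d → R) (i k : Fin m) (hik : k ≤ i) :
    linComb ι b x i k = 0 := by
  simp [linComb_apply, h _ i k hik]

theorem linComb_pow_eq_zero {ι : S →+* R} {b : Fin d → Matrix (Fin m) (Fin m) S}
    (h : ∀ l i k, k ≤ i → b l i k = 0) (x : Fin d → R) : linComb ι b x ^ (m + 1) = 0 := by
  rw [pow_succ, pow_eq_zero_of_strictUpper (linComb_strictUpper h x), zero_mul]

end LinearCombinations

namespace UnitriangularAlgGroup

variable {n : ℕ} (G : UnitriangularAlgGroup n)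

/-- The Lie algebra of `G` over `ℚ`. -/
def lieSubmodule : Submodule ℚ (Matrix (Fin n) (Fin n) ℚ) where
  carrier := {a | G.IsLie a}
  add_mem' := IsLie.add
  zero_mem' := isLie_zero
  smul_mem' := fun r _ h => IsLie.smul h r

/-- A basis of the Lie algebra of `G` whose members have entries in a ring `S` with a homomorphism
`j` to `ℚ`, with linear forms over `S` giving the coordinates. -/
structure LieBasis (S : Type) [CommRing S] (j : S →+* ℚ) (d : ℕ) where
  b : Fin d → Matrix (Fin n) (Fin n) S
  t : Fin d → Matrix (Fin n) (Fin n) S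
  dual : ∀ i k, ∑ p : Fin n × Fin n, t i p.1 p.2 * b k p.1 p.2 = if i = k then 1 else 0
  strictUpper : ∀ l i k, k ≤ i → b l i k = 0
  isLie : ∀ i, G.IsLie ((b i).map j)
  span : ∀ (R : Type) [CommRing R] [Algebra ℚ R] (a : Matrix (Fin n) (Fin n) R), G.IsLie a →
    linComb ((algebraMap ℚ R).comp j) b (linCoord ((algebraMap ℚ R).comp j) t a) = a

theorem exists_lieBasis_rat : ∃ d, Nonempty (G.LieBasis ℚ (RingHom.id ℚ) d) := by
  classical
  let V := G.lieSubmodule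
  let β := Module.finBasis ℚ V
  -- A linear retraction onto the Lie algebra extends the coordinate forms to all matrices, which
  -- makes them polynomial functions of the matrix entries.
  obtain ⟨π, hπ⟩ := V.subtype.exists_leftInverse_of_injective (by simp)
  have hπ' : ∀ v : V, π v = v := fun v => LinearMap.congr_fun hπ v
  let t : Fin (Module.finrank ℚ V) → Matrix (Fin n) (Fin n) ℚ := fun i => Matrix.of fun k l =>
    β.repr (π (Matrix.single k l 1)) i
  have ht : ∀ i (a : Matrix (Fin n) (Fin n) ℚ),
      ∑ p : Fin n × Fin n, t i p.1 p.2 * a p.1 p.2 = β.repr (π a) i := by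
    intro i a
    conv_rhs => rw [Matrix.matrix_eq_sum_single a]
    rw [Fintype.sum_prod_type]
    simp only [map_sum, Finsupp.coe_finsetSum, Finset.sum_apply]
    refine Finset.sum_congr rfl fun k _ => Finset.sum_congr rfl fun l _ => ?_
    have : Matrix.single k l (a k l) = a k l • Matrix.single k l (1 : ℚ) := by
      rw [Matrix.smul_single]; simp
    rw [this, map_smul, map_smul, Finsupp.smul_apply, smul_eq_mul, mul_comm]
    rfl
  have hspan : ∀ a : Matrix (Fin n) (Fin n) ℚ, G.IsLie a →
      ∑ i, (∑ p : Fin n × Fin n, t i p.1 p.2 * a p.1 p.2) • (β i : Matrix (Fin n) (Fin n) ℚ) =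
        a := by
    intro a ha
    have h1 := β.sum_repr ⟨a, ha⟩
    have h2 := congrArg V.subtype h1
    rw [map_sum] at h2
    refine Eq.trans (Finset.sum_congr rfl fun i _ => ?_) h2
    rw [ht, map_smul, hπ' ⟨a, ha⟩]
    rfl
  refine ⟨Module.finrank ℚ V, ⟨⟨fun i => β i, t, ?_, ?_, ?_, ?_⟩⟩⟩
  · intro i k
    rw [ht, hπ', β.repr_self, Finsupp.single_apply]
    simp [eq_comm]
  · exact fun l i k hik => IsLie.strictUpper (β l).2 i k hik
  · exact fun i => (β i).2
  · intro R _ _ a ha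
    ext i k
    -- Linear functionals on R reduce the identity to rational matrices, because they preserve
    -- membership in the Lie algebra.
    rw [← sub_eq_zero, ← Module.forall_dual_apply_eq_zero_iff ℚ]
    intro l
    have h1 := congrFun (congrFun (hspan _ (ha.map l)) i) k
    rw [map_sub, sub_eq_zero, linComb_apply, map_sum]
    refine Eq.trans ?_ h1
    rw [Matrix.sum_apply]
    refine Finset.sum_congr rfl fun q _ => ?_
    simp only [linCoord, RingHom.comp_id, Matrix.smul_apply, Matrix.map_apply, smul_eq_mul]
    rw [mul_comm, ← Algebra.smul_def, map_smul, map_sum, smul_eq_mul, mul_comm]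
    congr 1
    refine Finset.sum_congr rfl fun p _ => ?_
    rw [← Algebra.smul_def, map_smul, smul_eq_mul]

namespace LieBasis

variable {G} {S : Type} [CommRing S] {j : S →+* ℚ} {d : ℕ} (B : G.LieBasis S j d)

theorem isLie_linComb {R : Type} [CommRing R] [Algebra ℚ R] (x : Fin d → R) :
    G.IsLie (linComb ((algebraMap ℚ R).comp j) B.b x) := by
  refine IsLie.sum _ fun i _ => IsLie.smul ?_ _
  exact (B.isLie i).map (Algebra.linearMap ℚ R)

theorem exists_bracket {R : Type} [CommRing R] [Algebra ℚ R] (x y : Fin d → R) :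
    ∃ z, linComb ((algebraMap ℚ R).comp j) B.b z =
      linComb ((algebraMap ℚ R).comp j) B.b x * linComb ((algebraMap ℚ R).comp j) B.b y -
      linComb ((algebraMap ℚ R).comp j) B.b y * linComb ((algebraMap ℚ R).comp j) B.b x :=
  ⟨_, B.span R _ ((B.isLie_linComb x).bracket (B.isLie_linComb y))⟩

variable [IsAddTorsionFree S] (c : ℕ → S) (hc : ∀ k ≤ n, c k * (k.factorial : S) = 1)

/-- The exponential chart of `G`. -/
def expChart : AffineChart S d n where
  mat := algExp c n MvPolynomial.C (linComb MvPolynomial.C B.b MvPolynomial.X)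
  coord := linCoord MvPolynomial.C B.t (algLog c n MvPolynomial.C
    (Matrix.of fun i k => MvPolynomial.X (i, k)))
  left_inv := fun i => by
    set P := algExp c n (MvPolynomial.C (σ := Fin d)) (linComb MvPolynomial.C B.b MvPolynomial.X) with hP
    have h1 := linCoord_map MvPolynomial.C (MvPolynomial.aeval (R := S)
      (fun p : Fin n × Fin n => P p.1 p.2)).toRingHom B.t
      (algLog c n (MvPolynomial.C (σ := Fin n × Fin n)) (Matrix.of fun i k => MvPolynomial.X (i, k))) i
    have h2 : (MvPolynomial.aeval (R := S) (fun p : Fin n × Fin n => P p.1 p.2)).toRingHom.comp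
        MvPolynomial.C = MvPolynomial.C := by
      ext s; simp
    have h3 : (Matrix.of fun i k => (MvPolynomial.X (i, k) : MvPolynomial (Fin n × Fin n) S)).map
        (MvPolynomial.aeval (R := S) (fun p : Fin n × Fin n => P p.1 p.2)).toRingHom = P := by
      ext i k; simp
    rw [algLog_map, h2, h3, hP, algLog_algExp _ hc (linComb_pow_eq_zero B.strictUpper _),
      linCoord_linComb B.dual] at h1
    exact h1

theorem pt_expChart {R : Type*} [CommRing R] (ι : S →+* R) (x : Fin d → R) :
    (B.expChart c hc).pt ι x = algExp c n ι (linComb ι B.b x) := by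
  have h : (MvPolynomial.eval₂Hom ι x).comp MvPolynomial.C = ι := by
    ext s; simp
  refine (algExp_map _ _ _ _ _).trans ?_
  rw [linComb_map, h]
  simp

omit [IsAddTorsionFree S] in
include hc in
theorem algExp_comp {R : Type} [CommRing R] [Algebra ℚ R] (a : Matrix (Fin n) (Fin n) R) :
    algExp c n ((algebraMap ℚ R).comp j) a = algExp ratCoeff n (algebraMap ℚ R) a := by
  rw [algExp_eq_sum, algExp_eq_sum]
  refine Finset.sum_congr rfl fun k hk => ?_
  have h := congrArg j (hc k (by rw [Finset.mem_range] at hk; omega))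
  rw [map_mul, map_one, map_natCast] at h
  rw [RingHom.comp_apply, eq_inv_of_mul_eq_one_left h]
  rfl

/-- The exponential of a generic Lie algebra element is a point of G, and every point of G is the
exponential of its logarithm. Agreement of points over all ℚ-algebras forces equality of the ideals,
with no reducedness needed. -/
theorem ideal_expChart : G.ideal = (B.expChart c hc).ideal j := by
  refine AffineChart.ideal_eq _ j ?_ fun R _ _ A hA => ?_
  · rw [AffineChart.genericPt, pt_expChart, ← MvPolynomial.algebraMap_eq, algExp_comp c hc]
    exact matrixZero_algExp (B.isLie_linComb _)
  · refine ⟨linCoord ((algebraMap ℚ R).comp j) B.t (algLog ratCoeff n (algebraMap ℚ R) A),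
      (B.pt_expChart c hc _ _).trans ?_⟩
    rw [B.span R _ (isLie_algLog hA), algExp_comp c hc]
    exact algExp_algLog _ (fun k _ => ratCoeff_mul k) (sub_one_pow_eq_zero hA)

end LieBasis

end UnitriangularAlgGroup

/-! ### Rings of fractions ℤ[1/N] and their reductions -/

section Denominators

/-- The rational numbers whose denominators divide a power of `N`. -/
def denomSubring (N : ℕ) : Subring ℚ where
  carrier := {q | ∃ k, q.den ∣ N ^ k}
  mul_mem' := by
    rintro a b ⟨k, hk⟩ ⟨l, hl⟩
    exact ⟨k + l, (Rat.mul_den_dvd a b).trans (by rw [pow_add]; exact mul_dvd_mul hk hl)⟩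
  one_mem' := ⟨0, by simp⟩
  add_mem' := by
    rintro a b ⟨k, hk⟩ ⟨l, hl⟩
    exact ⟨k + l, (Rat.add_den_dvd a b).trans (by rw [pow_add]; exact mul_dvd_mul hk hl)⟩
  zero_mem' := ⟨0, by simp⟩
  neg_mem' := by
    rintro a ⟨k, hk⟩
    exact ⟨k, by rwa [Rat.neg_den]⟩

theorem mem_denomSubring_of_dvd {N : ℕ} {q : ℚ} (h : q.den ∣ N) : q ∈ denomSubring N :=
  ⟨1, by rwa [pow_one]⟩

theorem denomSubring_exists_unit (N : ℕ) (a : denomSubring N) :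
    ∃ M k : ℤ, IsUnit (M : denomSubring N) ∧ M * a = k := by
  obtain ⟨k, hk⟩ := a.2
  have h0 : ((a : ℚ).den : ℚ) ≠ 0 := by exact_mod_cast (a : ℚ).den_ne_zero
  refine ⟨(a : ℚ).den, (a : ℚ).num, ?_, ?_⟩
  · refine IsUnit.of_mul_eq_one ⟨((a : ℚ).den : ℚ)⁻¹, k, ?_⟩ ?_
    · rwa [Rat.inv_natCast_den_of_pos (a : ℚ).den_pos]
    · apply Subtype.ext
      push_cast
      exact mul_inv_cancel₀ h0
  · apply Subtype.ext
    push_cast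
    rw [mul_comm]
    exact Rat.mul_den_eq_num _

/-- Reduction of rational numbers to a field in which their denominators do not vanish. -/
def denomSubringToField (N : ℕ) (F : Type*) [Field F] (hN : (N : F) ≠ 0) :
    denomSubring N →+* F :=
  have h : ∀ q : denomSubring N, ((q : ℚ).den : F) ≠ 0 := fun q h0 => by
    obtain ⟨k, l, hl⟩ := q.2
    have := congrArg (Nat.cast : ℕ → F) hl
    push_cast at this
    rw [h0, zero_mul] at this
    exact pow_ne_zero k hN this
  { toFun := fun q => ((q : ℚ) : F)
    map_one' := by simp
    map_zero' := by simp
    map_mul' := fun a b => by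
      rw [Subring.coe_mul, Rat.cast_mul_of_ne_zero (h a) (h b)]
    map_add' := fun a b => by
      rw [Subring.coe_add, Rat.cast_add_of_ne_zero (h a) (h b)] }

theorem exists_denom_finset (s : Finset ℚ) : ∃ N : ℕ, 0 < N ∧ ∀ q ∈ s, q.den ∣ N :=
  ⟨∏ q ∈ s, q.den, Finset.prod_pos fun q _ => q.den_pos, fun _ hq => Finset.dvd_prod_of_mem _ hq⟩

end Denominators

namespace UnitriangularAlgGroup

variable {n : ℕ} (G : UnitriangularAlgGroup n)

/-- The basis of the Lie algebra can be defined over the subring of `ℚ` generated by the inverses of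
finitely many integers, which may be chosen to include a given one. -/
theorem exists_lieBasis (N₀ : ℕ) (hN₀ : 0 < N₀) : ∃ (d N : ℕ), 0 < N ∧ N₀ ∣ N ∧
    Nonempty (G.LieBasis (denomSubring N) (denomSubring N).subtype d) := by
  obtain ⟨d, ⟨B⟩⟩ := G.exists_lieBasis_rat
  obtain ⟨N, hN, hden⟩ := exists_denom_finset
    (Finset.univ.image (fun q : Fin d × Fin n × Fin n => B.b q.1 q.2.1 q.2.2) ∪
      Finset.univ.image (fun q : Fin d × Fin n × Fin n => B.t q.1 q.2.1 q.2.2))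
  have hb : ∀ i k l, B.b i k l ∈ denomSubring (N₀ * N) := fun i k l =>
    mem_denomSubring_of_dvd ((hden _ (Finset.mem_union_left _
      (Finset.mem_image.2 ⟨(i, k, l), Finset.mem_univ _, rfl⟩))).mul_left _)
  have ht : ∀ i k l, B.t i k l ∈ denomSubring (N₀ * N) := fun i k l =>
    mem_denomSubring_of_dvd ((hden _ (Finset.mem_union_right _
      (Finset.mem_image.2 ⟨(i, k, l), Finset.mem_univ _, rfl⟩))).mul_left _)
  refine ⟨d, N₀ * N, Nat.mul_pos hN₀ hN, dvd_mul_right _ _,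
    ⟨⟨fun i => Matrix.of fun k l => ⟨_, hb i k l⟩, fun i => Matrix.of fun k l => ⟨_, ht i k l⟩,
      ?_, ?_, ?_, ?_⟩⟩⟩
  · intro i k
    apply Subtype.ext
    have := B.dual i k
    push_cast
    simpa [apply_ite] using this
  · intro l i k hik
    exact Subtype.ext (B.strictUpper l i k hik)
  · exact B.isLie
  · exact B.span

end UnitriangularAlgGroup

/-! ### Block matrices supported on one superdiagonal -/

section Blocks

variable {r n : ℕ} {R R' : Type*} [CommRing R] [CommRing R']

/-- The block matrix with `r × r` blocks of size `n × n` having the block `a` on the `s`-th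
superdiagonal and zeros elsewhere. -/
def shiftBlock (r s : ℕ) (a : Matrix (Fin n) (Fin n) R) : Matrix (Fin (r * n)) (Fin (r * n)) R :=
  Matrix.of fun p q =>
    if ((finProdFinEquiv.symm p).1 : ℕ) + s = (finProdFinEquiv.symm q).1 then
      a (finProdFinEquiv.symm p).2 (finProdFinEquiv.symm q).2 else 0

/-- The block at position `(i, k)`. -/
def blockAt (i k : Fin r) (A : Matrix (Fin (r * n)) (Fin (r * n)) R) :
    Matrix (Fin n) (Fin n) R :=
  Matrix.of fun p q => A (finProdFinEquiv (i, p)) (finProdFinEquiv (k, q))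

theorem shiftBlock_apply (s : ℕ) (a : Matrix (Fin n) (Fin n) R) (i k : Fin r) (p q : Fin n) :
    shiftBlock r s a (finProdFinEquiv (i, p)) (finProdFinEquiv (k, q)) =
      if (i : ℕ) + s = k then a p q else 0 := by
  simp only [shiftBlock, Matrix.of_apply, Equiv.symm_apply_apply]

omit [CommRing R] in
theorem matrix_ext_finProd {A B : Matrix (Fin (r * n)) (Fin (r * n)) R}
    (h : ∀ i k : Fin r, ∀ p q : Fin n, A (finProdFinEquiv (i, p)) (finProdFinEquiv (k, q)) =
      B (finProdFinEquiv (i, p)) (finProdFinEquiv (k, q))) : A = B := by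
  ext p q
  obtain ⟨⟨i, p⟩, rfl⟩ := finProdFinEquiv.surjective p
  obtain ⟨⟨k, q⟩, rfl⟩ := finProdFinEquiv.surjective q
  exact h i k p q

theorem shiftBlock_mul (s t : ℕ) (a b : Matrix (Fin n) (Fin n) R) :
    shiftBlock r s a * shiftBlock r t b = shiftBlock r (s + t) (a * b) := by
  refine matrix_ext_finProd fun i k p q => ?_
  rw [Matrix.mul_apply, ← finProdFinEquiv.sum_comp, Fintype.sum_prod_type]
  simp only [shiftBlock_apply]
  split_ifs with h
  · rw [Finset.sum_eq_single (⟨(i : ℕ) + s, by omega⟩ : Fin r)]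
    · simp [Matrix.mul_apply, h, add_assoc]
    · intro l _ hl
      refine Finset.sum_eq_zero fun x _ => ?_
      rw [if_neg, zero_mul]
      exact fun e => hl (Fin.ext e.symm)
    · simp
  · refine Finset.sum_eq_zero fun l _ => Finset.sum_eq_zero fun x _ => ?_
    split_ifs with h1 h2
    · omega
    all_goals simp

theorem shiftBlock_add (s : ℕ) (a b : Matrix (Fin n) (Fin n) R) :
    shiftBlock r s (a + b) = shiftBlock r s a + shiftBlock r s b := by
  refine matrix_ext_finProd fun i k p q => ?_
  simp only [shiftBlock_apply, Matrix.add_apply]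
  split_ifs <;> simp

theorem shiftBlock_zero (s : ℕ) : shiftBlock r s (0 : Matrix (Fin n) (Fin n) R) = 0 := by
  refine matrix_ext_finProd fun i k p q => ?_
  simp [shiftBlock_apply]

theorem shiftBlock_of_le {s : ℕ} (h : r ≤ s) (a : Matrix (Fin n) (Fin n) R) :
    shiftBlock r s a = 0 := by
  refine matrix_ext_finProd fun i k p q => ?_
  rw [shiftBlock_apply, if_neg (by omega), Matrix.zero_apply]

theorem shiftBlock_map (φ : R →+* R') (s : ℕ) (a : Matrix (Fin n) (Fin n) R) :
    (shiftBlock r s a).map φ = shiftBlock r s (a.map φ) := by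
  refine matrix_ext_finProd fun i k p q => ?_
  simp only [shiftBlock_apply, Matrix.map_apply]
  split_ifs <;> simp

theorem shiftBlock_apply_of_le (s : ℕ) (a : Matrix (Fin n) (Fin n) R)
    (p q : Fin (r * n)) (h : q ≤ p) : shiftBlock r (s + 1) a p q = 0 := by
  obtain ⟨⟨i, p⟩, rfl⟩ := finProdFinEquiv.surjective p
  obtain ⟨⟨k, q⟩, rfl⟩ := finProdFinEquiv.surjective q
  rw [shiftBlock_apply, if_neg]
  intro hik
  have h1 : (q : ℕ) + n * k ≤ p + n * i := h
  have h2 : n * (k : ℕ) = n * i + n * s + n := by rw [← hik]; ring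
  have := p.2
  omega

theorem blockAt_add (i k : Fin r) (A B : Matrix (Fin (r * n)) (Fin (r * n)) R) :
    blockAt i k (A + B) = blockAt i k A + blockAt i k B := rfl

theorem blockAt_map (φ : R →+* R') (i k : Fin r) (A : Matrix (Fin (r * n)) (Fin (r * n)) R) :
    (blockAt i k A).map φ = blockAt i k (A.map φ) := rfl

theorem blockAt_one_of_ne {i k : Fin r} (h : i ≠ k) :
    blockAt i k (1 : Matrix (Fin (r * n)) (Fin (r * n)) R) = 0 := by
  ext p q
  simp only [blockAt, Matrix.of_apply, Matrix.zero_apply]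
  exact Matrix.one_apply_ne fun e => h (Prod.ext_iff.1 (finProdFinEquiv.injective e)).1

theorem blockAt_shiftBlock (s : ℕ) (i k : Fin r) (a : Matrix (Fin n) (Fin n) R) :
    blockAt i k (shiftBlock r s a) = if (i : ℕ) + s = k then a else 0 := by
  ext p q
  simp only [blockAt, Matrix.of_apply, shiftBlock_apply]
  split_ifs <;> rfl

end Blocks

theorem linComb_smul {S R : Type*} [CommRing S] [CommRing R] {d m : ℕ} (ι : S →+* R)
    (b : Fin d → Matrix (Fin m) (Fin m) S) (r : R) (x : Fin d → R) :
    linComb ι b (r • x) = r • linComb ι b x := by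
  simp [linComb, Finset.smul_sum, smul_smul]

/-- Upper unitriangular matrices `1 + a` with strictly upper triangular `a`. -/
theorem one_add_apply_of_lt {R : Type*} [CommRing R] {m : ℕ} {a : Matrix (Fin m) (Fin m) R}
    (ha : ∀ i k, k ≤ i → a i k = 0) (i k : Fin m) (h : k < i) : (1 + a) i k = 0 := by
  rw [Matrix.add_apply, Matrix.one_apply_ne h.ne', ha i k h.le, add_zero]

theorem one_add_apply_self {R : Type*} [CommRing R] {m : ℕ} {a : Matrix (Fin m) (Fin m) R}
    (ha : ∀ i k, k ≤ i → a i k = 0) (i : Fin m) : (1 + a) i i = 1 := by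
  rw [Matrix.add_apply, Matrix.one_apply_eq, ha i i le_rfl, add_zero]

theorem eval₂Hom_comp_C {σ S R : Type*} [CommRing S] [CommRing R] (ι : S →+* R) (x : σ → R) :
    (MvPolynomial.eval₂Hom ι x).comp MvPolynomial.C = ι := by
  ext s; simp

theorem linComb_map_eval₂Hom {σ S R : Type*} [CommRing S] [CommRing R] {d m : ℕ} (ι : S →+* R)
    (x : σ → R) (b : Fin d → Matrix (Fin m) (Fin m) S) (u : Fin d → σ) :
    (linComb MvPolynomial.C b fun i => MvPolynomial.X (u i)).map (MvPolynomial.eval₂Hom ι x) =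
      linComb ι b fun i => x (u i) := by
  rw [linComb_map, eval₂Hom_comp_C]
  simp

theorem map_smul_mul {R R' : Type*} [CommRing R] [CommRing R'] {m : ℕ} (φ : R →+* R') (r : R)
    (a b : Matrix (Fin m) (Fin m) R) :
    (r • (a * b)).map φ = φ r • (a.map φ * b.map φ) := by
  rw [← Matrix.map_mul]
  ext i k
  rw [Matrix.map_apply, Matrix.smul_apply, smul_eq_mul, map_mul]
  rfl

/-! ### The matrices of M and H, and the groups they form -/

section ChartMatrices

variable {S R R' : Type*} [CommRing S] [CommRing R] [CommRing R'] {n d : ℕ}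
  (b : Fin d → Matrix (Fin n) (Fin n) S)

/-- The block matrix with blocks `1, a, 0, 1`, where `a` is a linear combination of the `b i`. -/
def abelianMat (ι : S →+* R) (x : Fin d → R) : Matrix (Fin (2 * n)) (Fin (2 * n)) R :=
  1 + shiftBlock 2 1 (linComb ι b x)

theorem abelianMat_mul (ι : S →+* R) (x y : Fin d → R) :
    abelianMat b ι x * abelianMat b ι y = abelianMat b ι (x + y) := by
  simp only [abelianMat, linComb_add, shiftBlock_add, add_mul, mul_add, shiftBlock_mul,
    shiftBlock_of_le (le_refl 2), one_mul, mul_one]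
  abel

theorem abelianMat_zero (ι : S →+* R) : abelianMat b ι (0 : Fin d → R) = 1 := by
  simp [abelianMat, linComb_zero, shiftBlock_zero]

/-- The block matrix with blocks `1, a, a' + a ^ 2 / 2, 1, a, 1` on and above the diagonal, where
`a` and `a'` are linear combinations of the `b i`, and `h = 1 / 2`. -/
def classTwoMat (h : S) (ι : S →+* R) (x y : Fin d → R) : Matrix (Fin (3 * n)) (Fin (3 * n)) R :=
  1 + (shiftBlock 3 1 (linComb ι b x) +
    shiftBlock 3 2 (linComb ι b y + ι h • (linComb ι b x * linComb ι b x)))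

theorem one_add_shiftBlock_mul (a c a' c' : Matrix (Fin n) (Fin n) R) :
    (1 + (shiftBlock 3 1 a + shiftBlock 3 2 c)) * (1 + (shiftBlock 3 1 a' + shiftBlock 3 2 c')) =
      1 + (shiftBlock 3 1 (a + a') + shiftBlock 3 2 (c + c' + a * a')) := by
  simp only [shiftBlock_add, add_mul, mul_add, shiftBlock_mul, one_mul, mul_one]
  rw [shiftBlock_of_le (by norm_num : 3 ≤ 1 + 2), shiftBlock_of_le (by norm_num : 3 ≤ 2 + 1),
    shiftBlock_of_le (by norm_num : 3 ≤ 2 + 2)]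
  abel

/-- The Baker–Campbell–Hausdorff formula in class two: xx' is the mixed part of (x + x')²/2 plus [x,
x']/2. Closure under products thus needs only that the bracket stays in the span. -/
theorem classTwoMat_mul {h : S} (hh : 2 * h = 1) (ι : S →+* R) (x y x' y' z : Fin d → R)
    (hz : linComb ι b z = linComb ι b x * linComb ι b x' - linComb ι b x' * linComb ι b x) :
    classTwoMat b h ι x y * classTwoMat b h ι x' y' =
      classTwoMat b h ι (x + x') (y + y' + ι h • z) := by
  have hh' : (1 : R) = ι h + ι h := by rw [← map_add, ← two_mul, hh, map_one]
  rw [classTwoMat, classTwoMat, one_add_shiftBlock_mul, classTwoMat]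
  simp only [linComb_add, linComb_smul, hz]
  congr 3
  have : linComb ι b x * linComb ι b x' = ι h • (linComb ι b x * linComb ι b x') +
      ι h • (linComb ι b x * linComb ι b x') := by rw [← add_smul, ← hh', one_smul]
  nth_rewrite 1 [this]
  simp only [add_mul, mul_add, smul_add, smul_sub]
  abel

theorem classTwoMat_zero (h : S) (ι : S →+* R) :
    classTwoMat b h ι (0 : Fin d → R) (0 : Fin d → R) = 1 := by
  simp [classTwoMat, linComb_zero, shiftBlock_zero]

theorem blockAt_classTwoMat_one (h : S) (ι : S →+* R) (x y : Fin d → R) :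
    blockAt 0 1 (classTwoMat b h ι x y) = linComb ι b x := by
  rw [classTwoMat, blockAt_add, blockAt_add, blockAt_one_of_ne (by decide), blockAt_shiftBlock,
    blockAt_shiftBlock]
  simp

theorem blockAt_classTwoMat_two (h : S) (ι : S →+* R) (x y : Fin d → R) :
    blockAt 0 2 (classTwoMat b h ι x y) =
      linComb ι b y + ι h • (linComb ι b x * linComb ι b x) := by
  rw [classTwoMat, blockAt_add, blockAt_add, blockAt_one_of_ne (by decide), blockAt_shiftBlock,
    blockAt_shiftBlock]
  simp

theorem blockAt_abelianMat (ι : S →+* R) (x : Fin d → R) :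
    blockAt 0 1 (abelianMat b ι x) = linComb ι b x := by
  rw [abelianMat, blockAt_add, blockAt_one_of_ne (by decide), blockAt_shiftBlock]
  simp

/-- The two products can differ only in the corner block, where the remaining terms are symmetric
and cancel; y and y' play no role. -/
theorem commute_classTwoMat_iff (h : S) (ι : S →+* R) (x y x' y' : Fin d → R) :
    Commute (classTwoMat b h ι x y) (classTwoMat b h ι x' y') ↔
      Commute (linComb ι b x) (linComb ι b x') := by
  rw [Commute, SemiconjBy, classTwoMat, classTwoMat, one_add_shiftBlock_mul,
    one_add_shiftBlock_mul]
  constructor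
  · intro e
    have h1 := congrArg (blockAt 0 2) e
    simp only [blockAt_add, blockAt_shiftBlock] at h1
    simp only [Fin.val_zero, Fin.val_two, zero_add, if_true] at h1
    rw [if_neg (by norm_num), if_neg (by norm_num)] at h1
    rw [Commute, SemiconjBy]
    have h2 := add_left_cancel (add_left_cancel h1)
    rw [add_comm (linComb ι b y' + _)] at h2
    exact add_left_cancel h2
  · intro e
    rw [e.eq, add_comm (linComb ι b x'), add_comm (linComb ι b y' + _)]

theorem abelianMat_map_eval₂Hom {σ : Type*} (ι : S →+* R) (x : σ → R) (u : Fin d → σ) :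
    (abelianMat b MvPolynomial.C fun i => MvPolynomial.X (u i)).map (MvPolynomial.eval₂Hom ι x) =
      abelianMat b ι fun i => x (u i) := by
  rw [abelianMat, Matrix.map_add _ (map_add _), Matrix.map_one _ (map_zero _) (map_one _),
    shiftBlock_map, linComb_map_eval₂Hom, abelianMat]

theorem classTwoMat_map_eval₂Hom {σ : Type*} (h : S) (ι : S →+* R) (x : σ → R)
    (u v : Fin d → σ) :
    (classTwoMat b h MvPolynomial.C (fun i => MvPolynomial.X (u i))
      fun i => MvPolynomial.X (v i)).map (MvPolynomial.eval₂Hom ι x) =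
      classTwoMat b h ι (fun i => x (u i)) fun i => x (v i) := by
  rw [classTwoMat, Matrix.map_add _ (map_add _), Matrix.map_add _ (map_add _),
    Matrix.map_one _ (map_zero _) (map_one _), shiftBlock_map, shiftBlock_map,
    linComb_map_eval₂Hom, Matrix.map_add _ (map_add _), linComb_map_eval₂Hom, classTwoMat]
  congr 4
  rw [map_smul_mul, linComb_map_eval₂Hom]
  simp

end ChartMatrices

namespace UnitriangularAlgGroup.LieBasis

variable {n : ℕ} {G : UnitriangularAlgGroup n} {S : Type} [CommRing S] {j : S →+* ℚ} {d : ℕ}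
  (B : G.LieBasis S j d)

/-- The generic matrix. -/
def genericMatrix (S : Type) [CommRing S] (m : ℕ) :
    Matrix (Fin m) (Fin m) (MvPolynomial (Fin m × Fin m) S) :=
  Matrix.of fun i k => MvPolynomial.X (i, k)

theorem genericMatrix_map {S R : Type} [CommRing S] [CommRing R] {m : ℕ} (ι : S →+* R)
    (A : Matrix (Fin m) (Fin m) R) :
    (genericMatrix S m).map (MvPolynomial.eval₂Hom ι fun p => A p.1 p.2) = A := by
  ext i k
  simp [genericMatrix]

/-- The chart of the commutative group attached to a Lie algebra. -/
def abelianChart : AffineChart S d (2 * n) where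
  mat := abelianMat B.b MvPolynomial.C MvPolynomial.X
  coord := linCoord MvPolynomial.C B.t (blockAt 0 1 (genericMatrix S (2 * n)))
  left_inv := fun i => by
    rw [aeval_eq_eval₂Hom, linCoord_map, eval₂Hom_comp_C, blockAt_map, genericMatrix_map,
      blockAt_abelianMat, MvPolynomial.algebraMap_eq, linCoord_linComb B.dual]

theorem pt_abelianChart {R : Type*} [CommRing R] (ι : S →+* R) (x : Fin d → R) :
    B.abelianChart.pt ι x = abelianMat B.b ι x :=
  abelianMat_map_eval₂Hom B.b ι x id

/-- The commutative group attached to a Lie algebra. -/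
def abelianGroup : UnitriangularAlgGroup (2 * n) :=
  B.abelianChart.toGroup j
    (fun i k h => by
      rw [AffineChart.genericPt, pt_abelianChart]
      exact one_add_apply_of_lt (shiftBlock_apply_of_le 0 _) i k h)
    (fun i => by
      rw [AffineChart.genericPt, pt_abelianChart]
      exact one_add_apply_self (shiftBlock_apply_of_le 0 _) i)
    (fun R _ _ => ⟨0, by rw [pt_abelianChart, abelianMat_zero]⟩)
    (fun R _ _ x y => ⟨x + y, by simp only [pt_abelianChart, abelianMat_mul]⟩)
    (fun R _ _ x => ⟨-x, by
      simp only [pt_abelianChart, abelianMat_mul, add_neg_cancel, abelianMat_zero]⟩)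

theorem abelianGroup_ideal : B.abelianGroup.ideal = B.abelianChart.ideal j := rfl

variable {h : S} (hh : 2 * h = 1)

/-- The chart of the group of class at most two attached to a Lie algebra. -/
def classTwoChart (h : S) : AffineChart S (d + d) (3 * n) where
  mat := classTwoMat B.b h MvPolynomial.C (fun i => MvPolynomial.X (Fin.castAdd d i))
    fun i => MvPolynomial.X (Fin.natAdd d i)
  coord := Fin.addCases
    (linCoord MvPolynomial.C B.t (blockAt 0 1 (genericMatrix S (3 * n))))
    (linCoord MvPolynomial.C B.t (blockAt 0 2 (genericMatrix S (3 * n)) -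
      MvPolynomial.C h • (blockAt 0 1 (genericMatrix S (3 * n)) *
        blockAt 0 1 (genericMatrix S (3 * n)))))
  left_inv := fun i => by
    have hsub : ∀ {R R' : Type} [CommRing R] [CommRing R'] (φ : R →+* R') (r : R)
        (A A' : Matrix (Fin n) (Fin n) R), (A - r • (A' * A')).map φ =
          A.map φ - φ r • (A'.map φ * A'.map φ) := by
      intro R R' _ _ φ r A A'
      rw [Matrix.map_sub _ (map_sub _), map_smul_mul]
    induction i using Fin.addCases with
    | left i =>
      rw [Fin.addCases_left, aeval_eq_eval₂Hom, linCoord_map, eval₂Hom_comp_C, blockAt_map,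
        genericMatrix_map, blockAt_classTwoMat_one, MvPolynomial.algebraMap_eq,
        linCoord_linComb B.dual]
    | right i =>
      rw [Fin.addCases_right, aeval_eq_eval₂Hom, linCoord_map, eval₂Hom_comp_C, hsub,
        blockAt_map, blockAt_map, genericMatrix_map, blockAt_classTwoMat_one,
        blockAt_classTwoMat_two, MvPolynomial.coe_eval₂Hom, MvPolynomial.eval₂_C,
        MvPolynomial.algebraMap_eq, add_sub_cancel_right, linCoord_linComb B.dual]

theorem pt_classTwoChart {R : Type*} [CommRing R] (ι : S →+* R) (x : Fin (d + d) → R) :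
    (B.classTwoChart h).pt ι x = classTwoMat B.b h ι (fun i => x (Fin.castAdd d i))
      fun i => x (Fin.natAdd d i) :=
  classTwoMat_map_eval₂Hom B.b h ι x _ _

theorem pt_classTwoChart_append {R : Type*} [CommRing R] (ι : S →+* R) (x y : Fin d → R) :
    (B.classTwoChart h).pt ι (Fin.append x y) = classTwoMat B.b h ι x y := by
  simp only [pt_classTwoChart, Fin.append_left, Fin.append_right]

include hh in
/-- The group of class at most two attached to a Lie algebra. -/
def classTwoGroup : UnitriangularAlgGroup (3 * n) :=
  (B.classTwoChart h).toGroup j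
    (fun i k hik => by
      rw [AffineChart.genericPt, pt_classTwoChart]
      refine one_add_apply_of_lt (fun p q hpq => ?_) i k hik
      rw [Matrix.add_apply, shiftBlock_apply_of_le 0 _ _ _ hpq, shiftBlock_apply_of_le 1 _ _ _ hpq,
        add_zero])
    (fun i => by
      rw [AffineChart.genericPt, pt_classTwoChart]
      refine one_add_apply_self (fun p q hpq => ?_) i
      rw [Matrix.add_apply, shiftBlock_apply_of_le 0 _ _ _ hpq, shiftBlock_apply_of_le 1 _ _ _ hpq,
        add_zero])
    (fun R _ _ => ⟨Fin.append 0 0, by rw [pt_classTwoChart_append, classTwoMat_zero]⟩)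
    (fun R _ _ x y => by
      obtain ⟨z, hz⟩ := B.exists_bracket (fun i => x (Fin.castAdd d i))
        (fun i => y (Fin.castAdd d i))
      rw [pt_classTwoChart, pt_classTwoChart, classTwoMat_mul B.b hh _ _ _ _ _ z hz]
      exact ⟨Fin.append _ _, B.pt_classTwoChart_append _ _ _⟩)
    (fun R _ _ x => ⟨-x, by
      -- An element commutes with its negative, so the bracket coordinates are zero.
      rw [pt_classTwoChart, pt_classTwoChart, classTwoMat_mul B.b hh _ _ _ _ _ 0]
      · rw [← classTwoMat_zero B.b h]
        congr 1
        · funext i; simp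
        · funext i; simp
      · have : (fun i => (-x) (Fin.castAdd d i)) = -fun i => x (Fin.castAdd d i) := rfl
        rw [this, linComb_neg, linComb_zero]
        simp⟩)

theorem classTwoGroup_ideal : (B.classTwoGroup hh).ideal = (B.classTwoChart h).ideal j := rfl

variable (hj : Function.Injective j) (hS : ∀ a : S, ∃ N k : ℤ, IsUnit (N : S) ∧ N * a = k)
include hj hS

theorem abelianGroup_isCommutative : B.abelianGroup.IsCommutative := by
  intro R _ _ a c
  obtain ⟨x, hx⟩ := (B.abelianChart.matrixZero_intIdeal_iff j hj hS _ B.abelianGroup_ideal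
    ((algebraMap ℚ R).comp j) _).1 a.2
  obtain ⟨y, hy⟩ := (B.abelianChart.matrixZero_intIdeal_iff j hj hS _ B.abelianGroup_ideal
    ((algebraMap ℚ R).comp j) _).1 c.2
  apply Subtype.ext
  apply Units.ext
  change ((a : GL (Fin (2 * n)) R) : Matrix (Fin (2 * n)) (Fin (2 * n)) R) * ((c : GL (Fin (2 * n)) R) : Matrix (Fin (2 * n)) (Fin (2 * n)) R) =
    ((c : GL (Fin (2 * n)) R) : Matrix (Fin (2 * n)) (Fin (2 * n)) R) * ((a : GL (Fin (2 * n)) R) : Matrix (Fin (2 * n)) (Fin (2 * n)) R)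
  rw [← hx, ← hy, pt_abelianChart, pt_abelianChart, abelianMat_mul, abelianMat_mul, add_comm]

open scoped commutatorElement in
-- The block at (0, 1) is additive on products, so it vanishes on commutators, and elements where it
-- vanishes are central.
theorem classTwoGroup_classLE : (B.classTwoGroup hh).ClassLE 2 := by
  intro R _ _
  have hpt : ∀ g : (B.classTwoGroup hh).points R, ∃ x y,
      classTwoMat B.b h ((algebraMap ℚ R).comp j) x y = ((g : GL (Fin (3 * n)) R) : Matrix (Fin (3 * n)) (Fin (3 * n)) R) := by
    intro g
    obtain ⟨x, hx⟩ := ((B.classTwoChart h).matrixZero_intIdeal_iff j hj hS _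
      (B.classTwoGroup_ideal hh) ((algebraMap ℚ R).comp j) _).1 g.2
    exact ⟨_, _, (B.pt_classTwoChart _ _).symm.trans hx⟩
  have hmul : ∀ g k : (B.classTwoGroup hh).points R,
      blockAt 0 1 (((g * k : (B.classTwoGroup hh).points R) : GL (Fin (3 * n)) R) : Matrix (Fin (3 * n)) (Fin (3 * n)) R) =
      blockAt 0 1 ((g : GL (Fin (3 * n)) R) : Matrix (Fin (3 * n)) (Fin (3 * n)) R) + blockAt 0 1 ((k : GL (Fin (3 * n)) R) : Matrix (Fin (3 * n)) (Fin (3 * n)) R) := by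
    intro g k
    obtain ⟨x, y, hg⟩ := hpt g
    obtain ⟨x', y', hk⟩ := hpt k
    rw [Subgroup.coe_mul, Units.val_mul, ← hg, ← hk, blockAt_classTwoMat_one,
      blockAt_classTwoMat_one, classTwoMat, classTwoMat, one_add_shiftBlock_mul, blockAt_add,
      blockAt_add, blockAt_shiftBlock, blockAt_shiftBlock, blockAt_one_of_ne (by decide)]
    simp
  have hcentral : ∀ g k : (B.classTwoGroup hh).points R,
      blockAt 0 1 ((g : GL (Fin (3 * n)) R) : Matrix (Fin (3 * n)) (Fin (3 * n)) R) = 0 → g * k = k * g := by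
    intro g k hg0
    obtain ⟨x, y, hg⟩ := hpt g
    obtain ⟨x', y', hk⟩ := hpt k
    apply Subtype.ext
    apply Units.ext
    rw [Subgroup.coe_mul, Subgroup.coe_mul, Units.val_mul, Units.val_mul, ← hg, ← hk]
    refine (commute_classTwoMat_iff B.b h _ x y x' y').2 ?_
    rw [← hg, blockAt_classTwoMat_one] at hg0
    rw [hg0]
    exact Commute.zero_left _
  rw [Subgroup.lowerCentralSeries_succ, eq_bot_iff, Subgroup.commutator_le]
  intro g hg k _
  have hgc : g ∈ Subgroup.center ((B.classTwoGroup hh).points R) := by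
    refine (?_ : (⊤ : Subgroup ((B.classTwoGroup hh).points R)).lowerCentralSeries 1 ≤ _) hg
    rw [Subgroup.lowerCentralSeries_succ, Subgroup.commutator_le]
    intro u _ v _
    rw [Subgroup.mem_center_iff]
    intro w
    refine (hcentral _ w ?_).symm
    -- Written without inverses, so that additivity of the block suffices.
    have h1 : ⁅u, v⁆ * (v * u) = u * v := by rw [commutatorElement_def]; group
    have h2 := congrArg (fun g : (B.classTwoGroup hh).points R =>
      blockAt 0 1 ((g : GL (Fin (3 * n)) R) : Matrix (Fin (3 * n)) (Fin (3 * n)) R)) h1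
    simp only [hmul] at h2
    rw [add_comm (blockAt 0 1 ((u : GL (Fin (3 * n)) R) : Matrix (Fin (3 * n)) (Fin (3 * n)) R))] at h2
    exact add_eq_right.1 h2
  rw [Subgroup.mem_bot, commutatorElement_eq_one_iff_mul_comm]
  exact (Subgroup.mem_center_iff.1 hgc k).symm

end UnitriangularAlgGroup.LieBasis

/-! ### Burnside's lemma and counting points in charts -/

/-- Row vectors, as a type on which matrix groups act from the right. -/
def RowVec (m : ℕ) (R : Type*) : Type _ := Fin m → R

/-- A matrix group acts on row vectors by multiplication with the inverse from the right. -/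
instance {m : ℕ} {R : Type*} [CommRing R] (Γ : Subgroup (GL (Fin m) R)) :
    MulAction Γ (RowVec m R) where
  smul g x := Matrix.vecMul x (((g⁻¹ : Γ) : GL (Fin m) R) : Matrix (Fin m) (Fin m) R)
  one_smul x := by
    change Matrix.vecMul x (((1⁻¹ : Γ) : GL (Fin m) R) : Matrix (Fin m) (Fin m) R) = x
    rw [inv_one, Subgroup.coe_one, Units.val_one]
    exact Matrix.vecMul_one _
  mul_smul g h x := by
    change Matrix.vecMul x ((((g * h)⁻¹ : Γ) : GL (Fin m) R) : Matrix (Fin m) (Fin m) R) =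
      (Matrix.vecMul x (((h⁻¹ : Γ) : GL (Fin m) R) : Matrix (Fin m) (Fin m) R)) ᵥ*
        (((g⁻¹ : Γ) : GL (Fin m) R) : Matrix (Fin m) (Fin m) R)
    rw [mul_inv_rev, Subgroup.coe_mul, Units.val_mul]
    exact (Matrix.vecMul_vecMul _ _ _).symm

/-- Burnside's lemma for the right action of a matrix group on row vectors. -/
theorem numLinearOrbits_mul_card {m : ℕ} {R : Type*} [CommRing R] (Γ : Subgroup (GL (Fin m) R)) :
    numLinearOrbits Γ * Nat.card Γ = Nat.card {p : Γ × (Fin m → R) //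
      p.2 ᵥ* ((p.1 : GL (Fin m) R) : Matrix (Fin m) (Fin m) R) = p.2} := by
  have hsmul : ∀ (g : Γ) (x : RowVec m R), g • x =
      Matrix.vecMul x (((g⁻¹ : Γ) : GL (Fin m) R) : Matrix (Fin m) (Fin m) R) := fun _ _ => rfl
  have hiff : ∀ (g : Γ) (x y : RowVec m R), g • y = x ↔
      Matrix.vecMul x ((g : GL (Fin m) R) : Matrix (Fin m) (Fin m) R) = y := fun g x y => by
    rw [smul_eq_iff_eq_inv_smul, hsmul, inv_inv]
    exact eq_comm
  have hquot : numLinearOrbits Γ = Nat.card (MulAction.orbitRel.Quotient Γ (RowVec m R)) :=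
    Nat.card_congr (Quotient.congr (Equiv.refl (Fin m → R) : (Fin m → R) ≃ RowVec m R)
      fun _ _ => ⟨fun ⟨g, hg, h⟩ => ⟨⟨g, hg⟩, (hiff _ _ _).2 h⟩,
        fun ⟨g, h⟩ => ⟨g, g.2, (hiff _ _ _).1 h⟩⟩)
  have e1 := Nat.card_congr (MulAction.sigmaFixedByEquivOrbitsProdGroup Γ (RowVec m R))
  rw [Nat.card_prod] at e1
  rw [hquot]
  refine e1.symm.trans (Nat.card_congr ?_)
  exact (Equiv.sigmaCongrRight fun g => Equiv.subtypeEquivRight fun x => hiff g x x).trans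
    (Equiv.subtypeProdEquivSigmaSubtype fun (g : Γ) (x : RowVec m R) =>
      Matrix.vecMul x ((g : GL (Fin m) R) : Matrix (Fin m) (Fin m) R) = x).symm

section Points

variable {S : Type} [CommRing S] {e m : ℕ} (c : AffineChart S e m) {j : S →+* ℚ}
  (hj : Function.Injective j) (hS : ∀ a : S, ∃ N k : ℤ, IsUnit (N : S) ∧ N * a = k)
  (K : UnitriangularAlgGroup m) (hK : K.ideal = c.ideal j) {F : Type*} [Field F] (ι : S →+* F)
include hj hS hK ι

theorem AffineChart.exists_pointsEquiv : ∃ E : (Fin e → F) ≃ K.points F,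
    ∀ x, ((E x : GL (Fin m) F) : Matrix (Fin m) (Fin m) F) = c.pt ι x := by
  have hmem := c.matrixZero_intIdeal_iff j hj hS K hK ι
  have hex : ∀ x, ∃ g : K.points F, ((g : GL (Fin m) F) : Matrix (Fin m) (Fin m) F) = c.pt ι x := by
    intro x
    have h0 := (hmem (c.pt ι x)).2 ⟨x, rfl⟩
    exact ⟨⟨Matrix.GeneralLinearGroup.mkOfDetNeZero (c.pt ι x)
      (by rw [K.det_of_matrixZero h0]; exact one_ne_zero), h0⟩, rfl⟩
  choose f hf using hex
  refine ⟨Equiv.ofBijective f ⟨fun x y hxy => ?_, fun g => ?_⟩, hf⟩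
  · exact c.pt_injective ι (by rw [← hf, ← hf, hxy])
  · obtain ⟨x, hx⟩ := (hmem _).1 g.2
    exact ⟨x, Subtype.ext (Units.ext ((hf x).trans hx))⟩

theorem AffineChart.card_points : Nat.card (K.points F) = Nat.card F ^ e := by
  obtain ⟨E, -⟩ := c.exists_pointsEquiv hj hS K hK ι
  rw [← Nat.card_congr E, Nat.card_fun, Nat.card_fin]

theorem AffineChart.numLinearOrbits_mul : numLinearOrbits (K.points F) * Nat.card F ^ e =
    Nat.card {p : (Fin e → F) × (Fin m → F) // p.2 ᵥ* c.pt ι p.1 = p.2} := by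
  rw [← c.card_points hj hS K hK ι, numLinearOrbits_mul_card]
  obtain ⟨E, hE⟩ := c.exists_pointsEquiv hj hS K hK ι
  refine (Nat.card_congr (Equiv.subtypeEquiv (E.prodCongr (Equiv.refl _)) fun p => ?_)).symm
  simp [hE]

/-- Burnside's lemma for conjugation: class number times order counts commuting pairs, here
expressed in chart coordinates. -/
theorem AffineChart.classNumber_mul : classNumber (K.points F) * Nat.card F ^ e =
    Nat.card {p : (Fin e → F) × (Fin e → F) // Commute (c.pt ι p.1) (c.pt ι p.2)} := by
  rw [← c.card_points hj hS K hK ι, classNumber, ← card_comm_eq_card_conjClasses_mul_card]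
  obtain ⟨E, hE⟩ := c.exists_pointsEquiv hj hS K hK ι
  refine (Nat.card_congr (Equiv.subtypeEquiv (E.prodCongr E) fun p => ?_)).symm
  rw [← hE, ← hE]
  simp only [Commute, SemiconjBy, Equiv.prodCongr_apply, Prod.map_fst, Prod.map_snd,
    ← Units.val_mul, Units.val_inj, ← Subgroup.coe_mul, Subtype.coe_inj]

end Points

/-- The vectors fixed by the exponential of a nilpotent matrix are those killed by the matrix. -/
theorem vecMul_algExp_eq_iff {S R : Type*} [CommRing S] [CommRing R] [IsAddTorsionFree S] {n m : ℕ}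
    {c : ℕ → S} (hc : ∀ k ≤ n, c k * (k.factorial : S) = 1) (ι : S →+* R)
    {a : Matrix (Fin m) (Fin m) R} (ha : a ^ (n + 1) = 0) (x : Fin m → R) :
    x ᵥ* algExp c n ι a = x ↔ x ᵥ* a = 0 := by
  constructor
  · intro h
    -- Here a = log (exp a) is a right multiple of exp a - 1; conversely exp a - 1 is a right
    -- multiple of a.
    obtain ⟨u, hu, -⟩ := exists_algLog_eq (c := c) (n := n) ι (algExp c n ι a)
    rw [algLog_algExp ι hc ha] at hu
    rw [hu, ← Matrix.vecMul_vecMul, Matrix.vecMul_sub, h, Matrix.vecMul_one, sub_self,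
      Matrix.zero_vecMul]
  · intro h
    obtain ⟨u, hu, -⟩ := exists_algExp_eq ι hc a
    rw [hu, Matrix.vecMul_add, Matrix.vecMul_one, ← Matrix.vecMul_vecMul, h, Matrix.zero_vecMul,
      add_zero]

theorem vecMul_shiftBlock_eq_zero_iff {n : ℕ} {R : Type*} [CommRing R]
    (a : Matrix (Fin n) (Fin n) R) (w : Fin (2 * n) → R) :
    w ᵥ* shiftBlock 2 1 a = 0 ↔ (fun k => w (finProdFinEquiv (0, k))) ᵥ* a = 0 := by
  have key : ∀ (i : Fin 2) (l : Fin n), (w ᵥ* shiftBlock 2 1 a) (finProdFinEquiv (i, l)) =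
      if i = 1 then ((fun k => w (finProdFinEquiv (0, k))) ᵥ* a) l else 0 := by
    intro i l
    simp only [Matrix.vecMul, dotProduct]
    rw [← finProdFinEquiv.sum_comp, Fintype.sum_prod_type, Fin.sum_univ_two]
    simp only [shiftBlock_apply]
    fin_cases i <;> simp
  constructor
  · intro h
    funext l
    have := key 1 l
    rw [h] at this
    simpa using this.symm
  · intro h
    funext q
    obtain ⟨⟨i, l⟩, rfl⟩ := finProdFinEquiv.surjective q
    rw [key, h]
    simp

/-- The order of F is zero in F, so the Bézout identity shows that N is invertible there. -/
theorem natCast_ne_zero_of_gcd_card {F : Type*} [Field F] [Finite F] {N : ℕ}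
    (h : Nat.gcd (Nat.card F) N = 1) : (N : F) ≠ 0 := by
  intro h0
  have h1 : (Nat.card F : F) = 0 := by
    have := Fintype.ofFinite F
    rw [Nat.card_eq_fintype_card]
    exact FiniteField.cast_card_eq_zero F
  have h2 := Nat.gcd_eq_gcd_ab (Nat.card F) N
  rw [h] at h2
  have h3 := congrArg (Int.cast : ℤ → F) h2
  push_cast at h3
  rw [h0, h1] at h3
  simp at h3

/-- Splitting a vector with `2 n` entries into two halves. -/
def splitVec (n : ℕ) (F : Type*) : (Fin (2 * n) → F) ≃ (Fin n → F) × (Fin n → F) :=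
  ((finProdFinEquiv.arrowCongr (Equiv.refl F)).symm.trans (Equiv.curry (Fin 2) (Fin n) F)).trans
    (finTwoArrowEquiv _)

/-! ### Comparison of G with M and with H over finite fields -/

namespace UnitriangularAlgGroup.LieBasis

variable {n : ℕ} {G : UnitriangularAlgGroup n} {S : Type} [CommRing S] {j : S →+* ℚ} {d : ℕ}
  (B : G.LieBasis S j d) [IsAddTorsionFree S] {c : ℕ → S}
  (hc : ∀ k ≤ n, c k * (k.factorial : S) = 1) (hj : Function.Injective j)
  (hS : ∀ a : S, ∃ N k : ℤ, IsUnit (N : S) ∧ N * a = k)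
  {F : Type*} [Field F] [Finite F] (ι : S →+* F)
include B hc hj hS ι

theorem numLinearOrbits_abelianGroup :
    numLinearOrbits (B.abelianGroup.points F) =
      Nat.card F ^ n * numLinearOrbits (G.points F) := by
  have hq : 0 < Nat.card F ^ d := pow_pos Nat.card_pos _
  have h1 := (B.expChart c hc).numLinearOrbits_mul hj hS G (B.ideal_expChart c hc) ι
  have h2 := B.abelianChart.numLinearOrbits_mul hj hS B.abelianGroup B.abelianGroup_ideal ι
  refine Nat.eq_of_mul_eq_mul_right hq ?_
  rw [h2, mul_assoc, h1]
  have h3 : Nat.card F ^ n = Nat.card (Fin n → F) := by rw [Nat.card_fun, Nat.card_fin]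
  rw [h3, ← Nat.card_prod]
  -- Moves the second half of the vector, on which there is no condition, to the front.
  let E1 : (Fin d → F) × (Fin (2 * n) → F) ≃ (Fin n → F) × ((Fin d → F) × (Fin n → F)) :=
    ((Equiv.refl _).prodCongr ((splitVec n F).trans (Equiv.prodComm _ _))).trans
      ((Equiv.prodAssoc _ _ _).symm.trans ((Equiv.prodComm _ _).prodCongr (Equiv.refl _) |>.trans
        (Equiv.prodAssoc _ _ _)))
  have E2 : {p : (Fin n → F) × ((Fin d → F) × (Fin n → F)) //
      p.2.2 ᵥ* (B.expChart c hc).pt ι p.2.1 = p.2.2} ≃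
      (Fin n → F) × {p : (Fin d → F) × (Fin n → F) //
        p.2 ᵥ* (B.expChart c hc).pt ι p.1 = p.2} :=
    { toFun := fun p => (p.1.1, ⟨p.1.2, p.2⟩)
      invFun := fun p => ⟨(p.1, p.2.1), p.2.2⟩
      left_inv := fun _ => rfl
      right_inv := fun _ => rfl }
  refine Nat.card_congr ((Equiv.subtypeEquiv E1 fun p => ?_).trans E2)
  rw [pt_abelianChart, pt_expChart, vecMul_algExp_eq_iff hc ι
    (linComb_pow_eq_zero B.strictUpper _), abelianMat, Matrix.vecMul_add, Matrix.vecMul_one,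
    add_eq_left, vecMul_shiftBlock_eq_zero_iff]
  rfl

theorem classNumber_classTwoGroup {h : S} (hh : 2 * h = 1) :
    classNumber ((B.classTwoGroup hh).points F) =
      Nat.card F ^ d * classNumber (G.points F) := by
  have hq : 0 < Nat.card F ^ (d + d) := pow_pos Nat.card_pos _
  have h1 := (B.expChart c hc).classNumber_mul hj hS G (B.ideal_expChart c hc) ι
  have h2 := (B.classTwoChart h).classNumber_mul hj hS _ (B.classTwoGroup_ideal hh) ι
  refine Nat.eq_of_mul_eq_mul_right hq ?_
  have h3 : Nat.card F ^ d * classNumber (G.points F) * Nat.card F ^ (d + d) =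
      (Nat.card F ^ d * Nat.card F ^ d) * (classNumber (G.points F) * Nat.card F ^ d) := by ring
  have h4 : Nat.card F ^ d = Nat.card (Fin d → F) := by rw [Nat.card_fun, Nat.card_fin]
  rw [h2, h3, h1, h4, ← Nat.card_prod, ← Nat.card_prod]
  -- Regroups ((x, y), (x', y')) as ((y, y'), (x, x')): the central coordinates are free.
  let E1 : (Fin (d + d) → F) × (Fin (d + d) → F) ≃
      ((Fin d → F) × (Fin d → F)) × ((Fin d → F) × (Fin d → F)) :=
    (((Fin.appendEquiv d d).symm).prodCongr ((Fin.appendEquiv d d).symm)).trans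
      ((Equiv.prodProdProdComm _ _ _ _).trans (Equiv.prodComm _ _))
  have E2 : {p : ((Fin d → F) × (Fin d → F)) × ((Fin d → F) × (Fin d → F)) //
      Commute ((B.expChart c hc).pt ι p.2.1) ((B.expChart c hc).pt ι p.2.2)} ≃
      ((Fin d → F) × (Fin d → F)) × {p : (Fin d → F) × (Fin d → F) //
        Commute ((B.expChart c hc).pt ι p.1) ((B.expChart c hc).pt ι p.2)} :=
    { toFun := fun p => (p.1.1, ⟨p.1.2, p.2⟩)
      invFun := fun p => ⟨(p.1, p.2.1), p.2.2⟩
      left_inv := fun _ => rfl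
      right_inv := fun _ => rfl }
  have hnil := fun x : Fin d → F => linComb_pow_eq_zero (ι := ι) B.strictUpper x
  have hcomm : ∀ x y : Fin d → F,
      Commute ((B.expChart c hc).pt ι x) ((B.expChart c hc).pt ι y) ↔
        Commute (linComb ι B.b x) (linComb ι B.b y) := by
    intro x y
    rw [pt_expChart, pt_expChart]
    refine ⟨commute_of_commute_algExp ι hc (hnil x) (hnil y), fun hxy => ?_⟩
    rw [algExp_eq_sum, algExp_eq_sum]
    exact Commute.sum_left _ _ _ fun k _ => Commute.sum_right _ _ _ fun l _ =>
      ((hxy.pow_pow k l).smul_left _).smul_right _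
  refine Nat.card_congr ((Equiv.subtypeEquiv E1 fun p => ?_).trans E2)
  rw [pt_classTwoChart, pt_classTwoChart, commute_classTwoMat_iff, hcomm]
  rfl

end UnitriangularAlgGroup.LieBasis

end

theorem propositionB {n d : ℕ} (G : UnitriangularAlgGroup n) (hd : G.dim = d) :
    (∃ (M : UnitriangularAlgGroup (2 * n)) (u : ℕ),
      M.IsCommutative ∧ M.dim = d ∧ 1 ≤ u ∧
      ∀ (F : Type) [Field F] [Finite F], Nat.gcd (Nat.card F) u = 1 →
        (numLinearOrbits (G.points F) : ℚ) =
          (Nat.card F : ℚ) ^ (-(n : ℤ)) * (numLinearOrbits (M.points F) : ℚ)) ∧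
    (∃ (m : ℕ) (H : UnitriangularAlgGroup m) (v : ℕ),
      H.ClassLE 2 ∧ H.dim = ((2 * d : ℕ) : WithBot ℕ∞) ∧ 1 ≤ v ∧
      ∀ (F : Type) [Field F] [Finite F], Nat.gcd (Nat.card F) v = 1 →
        (classNumber (G.points F) : ℚ) =
          (Nat.card F : ℚ) ^ (-(d : ℤ)) * (classNumber (H.points F) : ℚ)) := by
  -- Inverting n! provides the coefficients of exp and log up to degree n. The extra factor 2 serves
  -- the group law of H and is needed when n < 2.
  obtain ⟨d', N, hN, hdvd, ⟨B⟩⟩ := G.exists_lieBasis (2 * n.factorial)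
    (Nat.mul_pos two_pos n.factorial_pos)
  have hmem : ∀ k : ℕ, 0 < k → k ∣ N → ((k : ℚ)⁻¹) ∈ denomSubring N := fun k hk hkN =>
    mem_denomSubring_of_dvd (by rwa [Rat.inv_natCast_den_of_pos hk])
  have hfact : ∀ k ≤ n, ((k.factorial : ℚ)⁻¹) ∈ denomSubring N := fun k hk =>
    hmem _ k.factorial_pos (((Nat.factorial_dvd_factorial hk).mul_left 2).trans hdvd)
  -- Beyond degree n the value is never used, so 0 is an arbitrary default.
  let c : ℕ → denomSubring N := fun k =>
    if hk : k ≤ n then ⟨(k.factorial : ℚ)⁻¹, hfact k hk⟩ else 0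
  have hc : ∀ k ≤ n, c k * (k.factorial : denomSubring N) = 1 := by
    intro k hk
    apply Subtype.ext
    simp only [c, dif_pos hk]
    push_cast
    exact inv_mul_cancel₀ (by exact_mod_cast k.factorial_ne_zero)
  obtain ⟨h, hh⟩ : ∃ h : denomSubring N, 2 * h = 1 := by
    refine ⟨⟨((2 : ℕ) : ℚ)⁻¹, hmem 2 two_pos ((dvd_mul_right _ _).trans hdvd)⟩, ?_⟩
    apply Subtype.ext
    change (2 : ℚ) * ((2 : ℕ) : ℚ)⁻¹ = 1
    norm_num
  have hj : Function.Injective (denomSubring N).subtype := Subtype.val_injective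
  have hS := denomSubring_exists_unit N
  -- The size of the Lie algebra basis is the Krull dimension of G, by the exponential chart.
  obtain rfl : d' = d := by
    have := (B.expChart c hc).dim_eq _ G (B.ideal_expChart c hc)
    rw [hd] at this
    exact_mod_cast this.symm
  refine ⟨⟨B.abelianGroup, N, B.abelianGroup_isCommutative hj hS,
    B.abelianChart.dim_eq _ _ B.abelianGroup_ideal, hN, fun F _ _ hF => ?_⟩,
    ⟨3 * n, B.classTwoGroup hh, N, B.classTwoGroup_classLE hh hj hS, ?_, hN, fun F _ _ hF => ?_⟩⟩
  · have hq : (Nat.card F : ℚ) ≠ 0 := by exact_mod_cast Nat.card_pos.ne'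
    rw [B.numLinearOrbits_abelianGroup hc hj hS
      (denomSubringToField N F (natCast_ne_zero_of_gcd_card hF))]
    push_cast
    rw [zpow_neg, zpow_natCast, inv_mul_cancel_left₀ (pow_ne_zero _ hq)]
  · rw [(B.classTwoChart h).dim_eq _ _ (B.classTwoGroup_ideal hh), two_mul]
  · have hq : (Nat.card F : ℚ) ≠ 0 := by exact_mod_cast Nat.card_pos.ne'
    rw [B.classNumber_classTwoGroup hc hj hS
      (denomSubringToField N F (natCast_ne_zero_of_gcd_card hF)) hh]
    push_cast
    rw [zpow_neg, zpow_natCast, inv_mul_cancel_left₀ (pow_ne_zero _ hq)]
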